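/- Let $f:\mathbb{H}\to\mathbb{C}$, $f\not\equiv 0$, be a weakly holomorphic modular function for $\mathrm{SL}(2,\mathbb{Z})$ (that is, $f$ is $\mathrm{SL}(2,\mathbb{Z})$-invariant, holomorphic on the upper half-plane $\mathbb{H}$ and meromorphic at the cusp $\infty$) which is real and non-negative on the arc $\{e^{it}:\pi/3\le t\le 2\pi/3\}$. For a hyperbolic matrix $A\in\mathrm{SL}(2,\mathbb{Z})$ with attracting fixed point $\tilde w$ and repelling fixed point $w$, let $Q(x,y)=ax^2+bxy+cy^2$ be the primitive integral quadratic form with $Q(w,1)=Q(\tilde w,1)=0$ and $\mathrm{sgn}(a)=\mathrm{sgn}(w-\tilde w)$, let $D=b^2-4ac$, and put $$I_f(A)=\int_{\tau_0}^{A\tau_0}\frac{f(\tau)\sqrt{D}}{Q(\tau,1)}\,d\tau ,$$ where $\tau_0\in\mathbb{H}$ is arbitrary; put $I_f(A)=0$ if $A$ is not hyperbolic. Let $T=\begin{pmatrix}1&1\\0&1\end{pmatrix}$ and $V=\begin{pmatrix}1&0\\1&1\end{pmatrix}$. For real $x>0$ define $A_0=I$ and, with $x_n=A_n(1)$ (the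 $n$-th fraction on the path from $1/1$ to $x$ in the Farey tree), $A_{n+1}=A_nV$ if $x<x_n$ and $A_{n+1}=A_nT$ if $x\ge x_n$. The $f$-Lyapunov exponent of $x$ is $$\Lambda_f(x)=\limsup_{n\to\infty}\frac{\mathrm{Re}(I_f(A_n))}{n}.$$ Let $\phi=\frac{1+\sqrt5}{2}=[\overline{1;1}]$ and $\psi=1+\sqrt2=[\overline{2;2}]$. The set $\mathcal{M}$ of Markov irrationalities consists of all numbers whose purely periodic continued fraction expansions occur in the tree generated as follows: start with the pair of neighbors $[\overline{1;1}],[\overline{2;2}]$, and between any two neighbors $w_1=[\overline{a_1;\ldots,a_r}]<w_2=[\overline{b_1;\ldots,b_s}]$, written with the periods produced by the construction, insert $w_2\odot w_1=[\overline{b_1;\ldots,b_s,a_1,\ldots,a_r}]$, so that $w_1,\,w_2\odot w_1$ and $w_2\odot w_1,\,w_2$ become pairs of neighbors. Then for every $w\in\mathcal{M}$ the values $\Lambda_f(\psi),\Lambda_f(w),\Lambda_f(\phi)$ are finite and $$\Lambda_f(\psi)\le\Lambda_f(w)\le\Lambda_f(\phi).$$ -/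

import Mathlib

open Filter Topology UpperHalfPlane Matrix.SpecialLinearGroup
open scoped MatrixGroups Manifold

noncomputable section

namespace MarkovLyapunov

/-- A weakly holomorphic modular function for `SL(2, ℤ)`: a function that is invariant under
`SL(2, ℤ)`, holomorphic on the upper half plane, and meromorphic at the cusp `∞`
(as a function of `q = exp (2 π i τ)` near `q = 0`). -/
structure IsWeaklyHolomorphicModularFunction (f : ℍ → ℂ) : Prop where
  invariant : ∀ (γ : SL(2, ℤ)) (τ : ℍ), f (γ • τ) = f τ
  holomorphic : MDiff f
  meromorphic_at_cusp : MeromorphicAt (UpperHalfPlane.cuspFunction 1 f) 0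

/-- `f` is real and non-negative on the arc `{e^{it} : π/3 ≤ t ≤ 2π/3}`. -/
def IsNonnegOnArc (f : ℍ → ℂ) : Prop :=
  ∀ t ∈ Set.Icc (Real.pi / 3) (2 * Real.pi / 3), ∀ τ : ℍ,
    (τ : ℂ) = Complex.exp (t * Complex.I) → (f τ).im = 0 ∧ 0 ≤ (f τ).re

/-! ### Cycle integrals -/

/-- For `A = !![α, β; γ, δ]`, the integer `g = gcd (γ, δ - α, β)` multiplied by `- sgn (tr A)`
(a nonzero integer when `A` is hyperbolic). -/
def formDivisor (A : SL(2, ℤ)) : ℤ :=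
  -(A 0 0 + A 1 1).sign * (Int.gcd (A 1 0) (Int.gcd (A 1 1 - A 0 0) (A 0 1)) : ℤ)

/-- The coefficients `(a, b, c)` of the form `Q(x, y) = a x² + b x y + c y²` attached to a
hyperbolic matrix `A`: the primitive integral form vanishing at the attracting fixed point `w'`
and the repelling fixed point `w` of `A` and with `sgn a = sgn (w - w')`;
see `formCoeff_spec`. -/
def formCoeff (A : SL(2, ℤ)) : ℤ × ℤ × ℤ :=
  (A 1 0 / formDivisor A, (A 1 1 - A 0 0) / formDivisor A, -A 0 1 / formDivisor A)

/-- The real number `w` is a fixed point of the Möbius transformation `A`. -/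
def IsFixedPoint (A : SL(2, ℤ)) (w : ℝ) : Prop :=
  A 1 0 * w + A 1 1 ≠ 0 ∧ (A 0 0 * w + A 0 1) / (A 1 0 * w + A 1 1) = w

/-- An attracting fixed point; the derivative of `A` at `w` is `(γ w + δ)⁻²`. -/
def IsAttractingFixedPoint (A : SL(2, ℤ)) (w : ℝ) : Prop :=
  IsFixedPoint A w ∧ |((A 1 0 * w + A 1 1) ^ 2)⁻¹| < 1

/-- A repelling fixed point. -/
def IsRepellingFixedPoint (A : SL(2, ℤ)) (w : ℝ) : Prop :=
  IsFixedPoint A w ∧ 1 < |((A 1 0 * w + A 1 1) ^ 2)⁻¹|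

/-- The discriminant `b² - 4ac` of the form attached to `A`. -/
def formDiscr (A : SL(2, ℤ)) : ℤ :=
  (formCoeff A).2.1 ^ 2 - 4 * (formCoeff A).1 * (formCoeff A).2.2

/-- The value `Q(z, 1)` of the form attached to `A`. -/
def formEval (A : SL(2, ℤ)) (z : ℂ) : ℂ :=
  (formCoeff A).1 * z ^ 2 + (formCoeff A).2.1 * z + (formCoeff A).2.2

/-- The cycle integral `I_f(A) = ∫_{τ₀}^{A τ₀} f(τ) √D / Q(τ, 1) dτ`, taken along the straight
segment from `τ₀` to `A τ₀` (the integrand is holomorphic on the upper half plane).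
By convention it is `0` when `A` is not hyperbolic. -/
def cycleIntegral (f : ℍ → ℂ) (τ₀ : ℍ) (A : SL(2, ℤ)) : ℂ :=
  open scoped Classical in
  if (A : Matrix (Fin 2) (Fin 2) ℤ).IsHyperbolic then
    ∫ s in (0 : ℝ)..1,
      (fun z : ℂ => f (ofComplex z) * (Real.sqrt (formDiscr A) : ℂ) / formEval A z)
        (AffineMap.lineMap (τ₀ : ℂ) ((A • τ₀ : ℍ) : ℂ) s) * (((A • τ₀ : ℍ) : ℂ) - τ₀)
  else 0

/-! ### Farey paths and the `f`-Lyapunov exponent -/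

/-- The matrix `T = !![1, 1; 0, 1]`. -/
def matT : SL(2, ℤ) := ⟨!![1, 1; 0, 1], by simp [Matrix.det_fin_two]⟩

/-- The matrix `V = !![1, 0; 1, 1]`. -/
def matV : SL(2, ℤ) := ⟨!![1, 0; 1, 1], by simp [Matrix.det_fin_two]⟩

/-- The Farey fraction `A(1) = (α + β) / (γ + δ)` with associated matrix
`A = !![α, β; γ, δ]` in `SL(2, ℕ₀)`; it is the median of `A(0) = β / δ` and `A(∞) = α / γ`. -/
def fareyFraction (A : SL(2, ℤ)) : ℝ :=
  ((A 0 0 + A 0 1 : ℤ) : ℝ) / ((A 1 0 + A 1 1 : ℤ) : ℝ)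

/-- The matrices `A_n` along the path in the Farey tree from `1/1` towards `x > 0`: at the Farey
fraction `x_n = A_n(1)` one descends to `A_n V (1) < x_n` if `x < x_n`, and to `A_n T (1) > x_n`
otherwise. (A rational `x` equals some `x_n`; the path then descends to a larger fraction and
afterwards always to smaller ones, so that it converges to `x`.) -/
def fareyMatrix (x : ℝ) : ℕ → SL(2, ℤ)
  | 0 => 1
  | n + 1 =>
    open scoped Classical in
    if x < fareyFraction (fareyMatrix x n) then fareyMatrix x n * matV
    else fareyMatrix x n * matT

/-- The `f`-Lyapunov exponent `Λ_f(x) = limsup Re (I_f(A_n)) / n` of a real number `x > 0`,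
the limit superior being taken in the extended reals. -/
def lyapunov (f : ℍ → ℂ) (τ₀ : ℍ) (x : ℝ) : EReal :=
  limsup (fun n : ℕ => (((cycleIntegral f τ₀ (fareyMatrix x n)).re / n : ℝ) : EReal)) atTop

/-! ### Markov irrationalities -/

/-- `x` has the infinite simple continued fraction expansion `[a 0; a 1, a 2, …]`. -/
def HasContFract (x : ℝ) (a : ℕ → ℕ) : Prop :=
  (GenContFract.of x).h = a 0 ∧ ∀ n, (GenContFract.of x).partDens.get? n = some (a (n + 1) : ℝ)

/-- `x` has the purely periodic continued fraction expansion with period `l`. -/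
def HasPeriod (x : ℝ) (l : List ℕ) : Prop :=
  l ≠ [] ∧ HasContFract x (fun n => l.getD (n % l.length) 0)

/-- Pairs of periods of neighbors `w₁ < w₂` in the Markov tree. One starts with the periods
`1, 1` and `2, 2` of `φ` and `ψ`; between neighbors `w₁, w₂` with periods `u, v` one inserts the
conjunction `w₂ ⊙ w₁`, whose period is the concatenation `v ++ u`. -/
inductive MarkovNeighbors : List ℕ → List ℕ → Prop
  | root : MarkovNeighbors [1, 1] [2, 2]
  | left {u v : List ℕ} : MarkovNeighbors u v → MarkovNeighbors u (v ++ u)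
  | right {u v : List ℕ} : MarkovNeighbors u v → MarkovNeighbors (v ++ u) v

/-- Markov irrationalities: the numbers whose purely periodic continued fraction expansion
appears in the Markov tree. -/
def IsMarkovIrrationality (w : ℝ) : Prop :=
  ∃ u v : List ℕ, MarkovNeighbors u v ∧ (HasPeriod w u ∨ HasPeriod w v)

/-! ### The attached form has the defining properties -/

/-- The form attached to a hyperbolic matrix is primitive, it vanishes at the attracting fixed
point `w'` and at the repelling fixed point `w`, and `sgn a = sgn (w - w')`. -/
theorem formCoeff_spec (A : SL(2, ℤ)) (hA : (A : Matrix (Fin 2) (Fin 2) ℤ).IsHyperbolic) :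
    Int.gcd (formCoeff A).1 (Int.gcd (formCoeff A).2.1 (formCoeff A).2.2) = 1 ∧
    ∃ w' w : ℝ, IsAttractingFixedPoint A w' ∧ IsRepellingFixedPoint A w ∧
      (formCoeff A).1 * w ^ 2 + (formCoeff A).2.1 * w + (formCoeff A).2.2 = 0 ∧
      (formCoeff A).1 * w' ^ 2 + (formCoeff A).2.1 * w' + (formCoeff A).2.2 = 0 ∧
      SignType.sign ((formCoeff A).1 : ℝ) = SignType.sign (w - w') := by
  have hdet : A 0 0 * A 1 1 - A 0 1 * A 1 0 = 1 := by
    have h := A.det_coe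
    rwa [Matrix.det_fin_two] at h
  have hdisc : 4 < (A 0 0 + A 1 1) ^ 2 := by
    have h := hA
    simp only [Matrix.IsHyperbolic, Matrix.discr_fin_two, Matrix.trace_fin_two,
      Matrix.det_fin_two] at h
    linarith
  have hdefk : formDivisor A = -(A 0 0 + A 1 1).sign *
    (Int.gcd (A 1 0) (Int.gcd (A 1 1 - A 0 0) (A 0 1)) : ℤ) := rfl
  have hc1 : (formCoeff A).1 = A 1 0 / formDivisor A := rfl
  have hc2 : (formCoeff A).2.1 = (A 1 1 - A 0 0) / formDivisor A := rfl
  have hc3 : (formCoeff A).2.2 = -A 0 1 / formDivisor A := rfl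
  simp only [IsAttractingFixedPoint, IsRepellingFixedPoint, IsFixedPoint]
  generalize formCoeff A = F at *
  generalize formDivisor A = k at *
  generalize A 0 0 = α at *
  generalize A 0 1 = β at *
  generalize A 1 0 = γ at *
  generalize A 1 1 = δ at *
  have ht : α + δ ≠ 0 := by
    intro h
    rw [h] at hdisc
    norm_num at hdisc
  have hγ : γ ≠ 0 := by
    rintro rfl
    have h1 : α * δ = 1 := by linarith
    rcases Int.mul_eq_one_iff_eq_one_or_neg_one.mp h1 with ⟨h, h'⟩ | ⟨h, h'⟩ <;> subst h h' <;>
      norm_num at hdisc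
  set g : ℤ := (Int.gcd γ (Int.gcd (δ - α) β) : ℤ) with hg
  have hgpos : 0 < g := by
    have : 0 < Int.gcd γ (Int.gcd (δ - α) β) := Int.gcd_pos_of_ne_zero_left _ hγ
    exact Int.natCast_pos.mpr this
  have hs : (α + δ).sign * (α + δ).sign = 1 := by
    rcases lt_or_gt_of_ne ht with h | h
    · rw [Int.sign_eq_neg_one_of_neg h]; norm_num
    · rw [Int.sign_eq_one_of_pos h]; norm_num
  have hst : 0 < (α + δ).sign * (α + δ) := by
    rw [Int.sign_mul_self_eq_abs]
    exact abs_pos.mpr ht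
  have hs0 : (α + δ).sign ≠ 0 := by
    intro h
    rw [h] at hs
    norm_num at hs
  generalize (α + δ).sign = s at *
  have hk0 : k ≠ 0 := by
    rw [hdefk]
    exact mul_ne_zero (neg_ne_zero.mpr hs0) hgpos.ne'
  have hkg : ∀ z : ℤ, g ∣ z → k ∣ z := by
    rintro z ⟨y, rfl⟩
    exact ⟨-s * y, by rw [hdefk]; linear_combination -g * y * hs⟩
  have e1 : γ = k * F.1 := by
    rw [hc1, Int.mul_ediv_cancel' (hkg _ (Int.gcd_dvd_left _ _))]
  have hg2 : g ∣ (Int.gcd (δ - α) β : ℤ) := Int.gcd_dvd_right _ _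
  have e2 : δ - α = k * F.2.1 := by
    rw [hc2, Int.mul_ediv_cancel' (hkg _ (hg2.trans (Int.gcd_dvd_left _ _)))]
  have e3 : -β = k * F.2.2 := by
    rw [hc3, Int.mul_ediv_cancel' (hkg _ ((hg2.trans (Int.gcd_dvd_right _ _)).neg_right))]
  refine ⟨?_, ?_⟩
  · have hna : k.natAbs = Int.gcd γ (Int.gcd (δ - α) β) := by
      have hsa : s.natAbs = 1 := Int.natAbs_of_isUnit (IsUnit.of_mul_eq_one _ hs)
      rw [hdefk, Int.natAbs_mul, Int.natAbs_neg, hsa, one_mul, hg, Int.natAbs_natCast]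
    have h2 : Int.gcd (δ - α) β = k.natAbs * Int.gcd F.2.1 F.2.2 := by
      rw [← Int.gcd_mul_left, ← e2, ← e3, Int.gcd_neg]
    have h3 : Int.gcd γ (Int.gcd (δ - α) β) =
        k.natAbs * Int.gcd F.1 (Int.gcd F.2.1 F.2.2) := by
      rw [h2]
      generalize Int.gcd F.2.1 F.2.2 = m
      rw [e1, Int.gcd_eq_natAbs, Int.gcd_eq_natAbs, Int.natAbs_mul, Int.natAbs_natCast,
        Int.natAbs_natCast, Nat.gcd_mul_left]
    have hkp : 0 < k.natAbs := Int.natAbs_pos.mpr hk0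
    rw [← hna] at h3
    exact (Nat.eq_of_mul_eq_mul_left hkp (by rw [mul_one]; exact h3)).symm
  · have hdet' : (α : ℝ) * δ - β * γ = 1 := by exact_mod_cast hdet
    have hdisc' : (4 : ℝ) < (α + δ) ^ 2 := by exact_mod_cast hdisc
    have hst' : (0 : ℝ) < s * (α + δ) := by exact_mod_cast hst
    have hs' : (s : ℝ) * s = 1 := by exact_mod_cast hs
    have hγ' : (γ : ℝ) ≠ 0 := by exact_mod_cast hγ
    have hk' : (k : ℝ) ≠ 0 := by exact_mod_cast hk0
    have hg' : (0 : ℝ) < g := by exact_mod_cast hgpos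
    have hdefk' : (k : ℝ) = -s * g := by exact_mod_cast hdefk
    have e1' : (γ : ℝ) = k * F.1 := by exact_mod_cast e1
    have e2' : (δ : ℝ) - α = k * F.2.1 := by exact_mod_cast e2
    have e3' : -(β : ℝ) = k * F.2.2 := by exact_mod_cast e3
    set r : ℝ := Real.sqrt ((α + δ) ^ 2 - 4) with hr
    have hr0 : 0 < r := Real.sqrt_pos.mpr (by linarith)
    have hr2 : r * r = (α + δ) ^ 2 - 4 := Real.mul_self_sqrt (by linarith)
    set p : ℝ := (α + δ + s * r) / 2 with hp
    set q : ℝ := (α + δ - s * r) / 2 with hq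
    have hpq : p * q = 1 := by
      rw [hp, hq]
      linear_combination (-1 / 4) * (r * r * hs' + hr2)
    have hlt : q ^ 2 < p ^ 2 := by
      have : p ^ 2 - q ^ 2 = s * (α + δ) * r := by rw [hp, hq]; ring
      nlinarith [mul_pos hst' hr0]
    have hpq2 : p ^ 2 * q ^ 2 = 1 := by rw [← mul_pow, hpq, one_pow]
    have hp1 : 1 < p ^ 2 := by nlinarith [sq_nonneg q, sq_nonneg p]
    have hq1 : q ^ 2 < 1 := by nlinarith [sq_nonneg q, sq_nonneg p]
    have hp0 : p ≠ 0 := left_ne_zero_of_mul_eq_one hpq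
    have hq0 : q ≠ 0 := right_ne_zero_of_mul_eq_one hpq
    have hw1 : (γ : ℝ) * ((p - δ) / γ) + δ = p := by field_simp; ring
    have hw2 : (γ : ℝ) * ((q - δ) / γ) + δ = q := by field_simp; ring
    have hpp : p * p = (α + δ) * p - 1 := by
      have : p + q = α + δ := by rw [hp, hq]; ring
      linear_combination p * this - hpq
    have hqq : q * q = (α + δ) * q - 1 := by
      have : p + q = α + δ := by rw [hp, hq]; ring
      linear_combination q * this - hpq
    have key : ∀ z : ℝ, z * z = (α + δ) * z - 1 →
        (γ : ℝ) * ((z - δ) / γ) ^ 2 + (δ - α) * ((z - δ) / γ) - β = 0 := by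
      intro z hz
      field_simp
      linear_combination hz + hdet'
    have key2 : ∀ z : ℝ, z * z = (α + δ) * z - 1 →
        F.1 * ((z - δ) / γ) ^ 2 + F.2.1 * ((z - δ) / γ) + (F.2.2 : ℝ) = 0 := by
      intro z hz
      have h := key z hz
      generalize (z - δ) / γ = y at *
      have : (k : ℝ) * (F.1 * y ^ 2 + F.2.1 * y + F.2.2) = 0 := by
        linear_combination h - y ^ 2 * e1' - y * e2' - e3'
      exact (mul_eq_zero.mp this).resolve_left hk'
    have fixed : ∀ z : ℝ, z ≠ 0 → z * z = (α + δ) * z - 1 →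
        (α * ((z - δ) / γ) + β) / z = (z - δ) / γ := by
      intro z hz0 hz
      field_simp
      linear_combination -hz - hdet'
    refine ⟨(p - δ) / γ, (q - δ) / γ, ?_, ?_, key2 q hqq, key2 p hpp, ?_⟩
    · rw [hw1]
      refine ⟨⟨hp0, fixed p hp0 hpp⟩, ?_⟩
      rw [abs_of_pos (by positivity)]
      exact inv_lt_one_of_one_lt₀ hp1
    · rw [hw2]
      refine ⟨⟨hq0, fixed q hq0 hqq⟩, ?_⟩
      rw [abs_of_pos (by positivity)]
      exact (one_lt_inv₀ (by positivity)).mpr hq1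
    · have hprod : 0 < (F.1 : ℝ) * ((q - δ) / γ - (p - δ) / γ) := by
        have hF : (F.1 : ℝ) * ((q - δ) / γ - (p - δ) / γ) = r / g := by
          have hF0 : (F.1 : ℝ) ≠ 0 := by
            intro h
            rw [h, mul_zero] at e1'
            exact hγ' e1'
          rw [hp, hq, e1', hdefk']
          have hs0' : (s : ℝ) ≠ 0 := by exact_mod_cast hs0
          field_simp
          ring
        rw [hF]
        positivity
      rcases pos_and_pos_or_neg_and_neg_of_mul_pos hprod with ⟨h1, h2⟩ | ⟨h1, h2⟩
      · rw [sign_pos h1, sign_pos h2]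
      · rw [sign_neg h1, sign_neg h2]

end MarkovLyapunov

end

/-! Write `ρ = e^{iπ/3}`. Both `T` and `V` map `ρ²` to `ρ`, so along a Farey path `A_{k+1} ρ² = A_k
ρ`, and the cycle integral of `A_n` from `ρ²` to `A_n ρ²` splits into `n` pieces, the `k`-th running
over the image of the arc under `A_k`. If `w > 0` and `-v < 0` are the attracting and the repelling
fixed point of `A_n`, then `√D / Q(z, 1) = 1 / (z + v) - 1 / (z - w)`. Pulling the `k`-th piece back
by `A_k` leaves `f` unchanged and only moves the two poles, to `u_k > 0` and `-p_k < 0`. Its real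
part is the integral over the arc of `f(e^{it}) sin t (K_c(u_k) + K_{-c}(p_k))`, where `c = 2 cos t
∈ [-1, 1]` and `K_c(x) = 1 / (x + 1/x - c)` (`re_primitive_sub`, `re_cycleIntegral_fareyMatrix`).

The number `u_k` shares `n - k` letters with the `k`-th tail of the path of `x`, and `p_k` depends
on `v` only through a word of `k` letters. A word of `m` letters contracts to size at most `1 / (m +
1)` (`letterAct_contraction`), so replacing `u_k` by the tail and `v` by any other start costs
`O(log n)` in total, which disappears after division by `n`. The weight `f(e^{it}) sin t` is
nonnegative on the arc, so it is enough to compare averages of `K_c` along Farey paths for each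
fixed `c`.

The path of a Markov irrationality is a concatenation of the blocks `TV` and `TTVV`, coming from the
pairs `1, 1` and `2, 2`, and every tail at the start of a block lies in `[φ, ψ]`. The sum of `K_c`
over one block lies between the silver and the golden mean times the block length, up to a
coboundary `G(y) - G(blk b y)` with `G` a multiple of `y / (√5 - c)²` up to a constant
(`blkSum_false_le`, `blkSum_true_le`, `le_blkSum_false`, `le_blkSum_true`). The coboundaries
telescope. At `φ` and `ψ` the blocks have fixed points, so there the averages are exact. Nothing
about the tree is used beyond the fact that its periods are composed of these two pairs. -/

noncomputable section

namespace MarkovLyapunov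

/-! ### The kernel `x / (x² - c x + 1) = 1 / (x + 1 / x - c)` -/

/-- The kernel `x / (x² - c x + 1) = 1 / (x + 1 / x - c)`. -/
def kernel (c x : ℝ) : ℝ := x / (x ^ 2 - c * x + 1)

theorem kernel_denom_pos {c : ℝ} (hc : |c| ≤ 1) (x : ℝ) : 0 < x ^ 2 - c * x + 1 := by
  obtain ⟨h1, h2⟩ := abs_le.mp hc
  nlinarith [sq_nonneg (x - c / 2)]

theorem kernel_nonneg {c x : ℝ} (hc : |c| ≤ 1) (hx : 0 < x) : 0 ≤ kernel c x :=
  div_nonneg hx.le (kernel_denom_pos hc x).le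

theorem kernel_le_one {c x : ℝ} (hc : |c| ≤ 1) : kernel c x ≤ 1 := by
  rw [kernel, div_le_one (kernel_denom_pos hc x)]
  obtain ⟨h1, h2⟩ := abs_le.mp hc
  nlinarith [sq_nonneg (x - 1)]

theorem abs_kernel_le_one {c x : ℝ} (hc : |c| ≤ 1) (hx : 0 < x) : |kernel c x| ≤ 1 := by
  rw [abs_of_nonneg (kernel_nonneg hc hx)]
  exact kernel_le_one hc

theorem kernel_inv (c : ℝ) {x : ℝ} (hx : 0 < x) : kernel c x⁻¹ = kernel c x := by
  have : x⁻¹ ^ 2 - c * x⁻¹ + 1 = (x ^ 2 - c * x + 1) / x ^ 2 := by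
    field_simp
    ring
  rw [kernel, kernel, this, div_div_eq_mul_div]
  congr 1
  field_simp

theorem kernel_eq (c : ℝ) {x : ℝ} (hx : 0 < x) : kernel c x = 1 / (x + 1 / x - c) := by
  have : x ^ 2 - c * x + 1 = x * (x + 1 / x - c) := by
    field_simp
    ring
  rw [kernel, this]
  rw [← div_div, div_self hx.ne']

/-- The coordinate `x / (1 + x)` makes the positive half-line bounded and is the one in which words
in `T` and `V` contract. The constant is `4 * 4`, from `(1 + x)² ≤ 4 (x² - c x + 1)`, used once for
each point. -/
theorem abs_kernel_sub_kernel_le {c x y : ℝ} (hc : |c| ≤ 1) (hx : 0 < x) (hy : 0 < y) :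
    |kernel c x - kernel c y| ≤ 16 * |x / (1 + x) - y / (1 + y)| := by
  obtain ⟨h1, h2⟩ := abs_le.mp hc
  have hdx := kernel_denom_pos hc x
  have hdy := kernel_denom_pos hc y
  have hx4 : (1 + x) ^ 2 ≤ 4 * (x ^ 2 - c * x + 1) := by nlinarith [sq_nonneg (x - 1)]
  have hy4 : (1 + y) ^ 2 ≤ 4 * (y ^ 2 - c * y + 1) := by nlinarith [sq_nonneg (y - 1)]
  have e1 : kernel c x - kernel c y =
      (x / (1 + x) - y / (1 + y)) * ((1 - x * y) / ((1 + x) * (1 + y))) *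
      (((1 + x) ^ 2 / (x ^ 2 - c * x + 1)) * ((1 + y) ^ 2 / (y ^ 2 - c * y + 1))) := by
    rw [kernel, kernel]
    generalize hX : x ^ 2 - c * x + 1 = X at hdx ⊢
    generalize hY : y ^ 2 - c * y + 1 = Y at hdy ⊢
    field_simp
    rw [← hX, ← hY]
    ring
  have b1 : |(1 - x * y) / ((1 + x) * (1 + y))| ≤ 1 := by
    rw [abs_div, abs_of_pos (by positivity : 0 < (1 + x) * (1 + y)), div_le_one (by positivity),
      abs_le]
    constructor <;> nlinarith [mul_pos hx hy]
  have b2 : (1 + x) ^ 2 / (x ^ 2 - c * x + 1) ≤ 4 := by rwa [div_le_iff₀ hdx]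
  have b3 : (1 + y) ^ 2 / (y ^ 2 - c * y + 1) ≤ 4 := by rwa [div_le_iff₀ hdy]
  have p2 : 0 ≤ (1 + x) ^ 2 / (x ^ 2 - c * x + 1) := by positivity
  have p3 : 0 ≤ (1 + y) ^ 2 / (y ^ 2 - c * y + 1) := by positivity
  rw [e1, abs_mul, abs_mul, abs_of_nonneg (mul_nonneg p2 p3)]
  calc _ ≤ |x / (1 + x) - y / (1 + y)| * 1 * (4 * 4) := by gcongr
    _ = _ := by ring

/-! ### Words in `T` and `V` acting on positive reals -/

/-- The Möbius action of `V` (for `true`) and of `T` (for `false`). -/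
def letterAct (b : Prop) [Decidable b] (x : ℝ) : ℝ := if b then x / (1 + x) else x + 1

theorem letterAct_pos (b : Prop) [Decidable b] {x : ℝ} (hx : 0 < x) : 0 < letterAct b x := by
  unfold letterAct
  split_ifs <;> positivity

/-- Two positive reals whose Farey paths share `m` letters are close. -/
theorem letterAct_contraction (b : ℕ → Prop) [∀ i, Decidable (b i)] (p q : ℕ → ℝ) (m : ℕ)
    (hp : 0 < p 0) (hq : 0 < q 0)
    (hps : ∀ i < m, p (i + 1) = letterAct (b i) (p i))
    (hqs : ∀ i < m, q (i + 1) = letterAct (b i) (q i)) :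
    |p m / (1 + p m) - q m / (1 + q m)| ≤ 1 / ((m : ℝ) + 1) := by
  -- The common word is one matrix of determinant 1 with nonnegative entries. Each letter adds one
  -- row to the other, which raises the sum of the entries by at least 1.
  have key : ∀ k ≤ m, ∃ α β γ δ : ℝ, 1 ≤ α ∧ 0 ≤ β ∧ 0 ≤ γ ∧ 1 ≤ δ ∧ α * δ - β * γ = 1 ∧
      (k : ℝ) + 2 ≤ α + β + γ + δ ∧ p k = (α * p 0 + β) / (γ * p 0 + δ) ∧
      q k = (α * q 0 + β) / (γ * q 0 + δ) := by
    intro k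
    induction k with
    | zero => exact fun _ => ⟨1, 0, 0, 1, by norm_num, by norm_num, by norm_num, by norm_num,
        by norm_num, by norm_num, by simp, by simp⟩
    | succ k ih =>
      intro hk
      obtain ⟨α, β, γ, δ, hα, hβ, hγ, hδ, hdet, hsum, hpk, hqk⟩ := ih (by omega)
      have d1 : 0 < γ * p 0 + δ := by positivity
      have d2 : 0 < γ * q 0 + δ := by positivity
      have d3 : 0 < α * p 0 + β := by positivity
      have d4 : 0 < α * q 0 + β := by positivity
      rw [hps k (by omega), hqs k (by omega), hpk, hqk]
      unfold letterAct
      split_ifs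
      · refine ⟨α, β, α + γ, β + δ, hα, hβ, by linarith, by linarith, by linarith, ?_, ?_, ?_⟩
        · push_cast; linarith
        · field_simp; ring
        · field_simp; ring
      · refine ⟨α + γ, β + δ, γ, δ, by linarith, by linarith, hγ, hδ, by linarith, ?_, ?_, ?_⟩
        · push_cast; linarith
        · field_simp; ring
        · field_simp; ring
  obtain ⟨α, β, γ, δ, hα, hβ, hγ, hδ, hdet, hsum, hpk, hqk⟩ := key m le_rfl
  have d1 : 0 < γ * p 0 + δ := by positivity
  have d2 : 0 < γ * q 0 + δ := by positivity
  have d3 : 0 < α * p 0 + β := by positivity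
  have d4 : 0 < α * q 0 + β := by positivity
  have d5 : 0 < (α + γ) * p 0 + (β + δ) := by linarith
  have d6 : 0 < (α + γ) * q 0 + (β + δ) := by linarith
  have e1 : ∀ a b : ℝ, 0 < a → 0 < b → a / b / (1 + a / b) = a / (a + b) := by
    intro a b ha hb
    field_simp
    ring
  have e : p m / (1 + p m) - q m / (1 + q m) =
      (p 0 - q 0) / (((α + γ) * p 0 + (β + δ)) * ((α + γ) * q 0 + (β + δ))) := by
    rw [hpk, hqk, e1 _ _ d3 d1, e1 _ _ d4 d2, div_sub_div _ _ (by positivity) (by positivity)]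
    congr 1
    · linear_combination (p 0 - q 0) * hdet
    · ring
  -- The two column sums are at least 1 and add up to at least `m + 2`. In the coordinate `x / (1 +
  -- x)` the word maps the half-line to an interval whose length is the reciprocal of their product.
  have hst : (m : ℝ) + 1 ≤ (α + γ) * (β + δ) := by nlinarith
  have hs : 0 < (α + γ) * (β + δ) := by positivity
  rw [e, abs_div, abs_of_pos (mul_pos d5 d6), div_le_div_iff₀ (mul_pos d5 d6) (by positivity),
    one_mul]
  have h1 : |p 0 - q 0| ≤ p 0 + q 0 := by
    rw [abs_le]; constructor <;> linarith
  calc |p 0 - q 0| * (m + 1) ≤ (p 0 + q 0) * ((α + γ) * (β + δ)) := by gcongr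
    _ ≤ _ := by
      have : 0 ≤ (α + γ) ^ 2 * (p 0 * q 0) + (β + δ) ^ 2 := by positivity
      linarith

/-! ### Blocks `TV` and `TTVV` -/

/-- The maps `y ↦ [1; 1, y]` (for `false`) and `y ↦ [2; 2, y]` (for `true`). -/
def blk (b : Bool) (y : ℝ) : ℝ := if b then 2 + y / (2 * y + 1) else 1 + y / (y + 1)

/-- The number of letters of a block. -/
def blkLen (b : Bool) : ℕ := if b then 4 else 2

/-- The sum of `h` over the tails of the Farey path of `blk b y` that precede `y`. -/
def blkSum (h : ℝ → ℝ) (b : Bool) (y : ℝ) : ℝ :=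
  if b then h (2 + y / (2 * y + 1)) + h (1 + y / (2 * y + 1)) + h (y / (2 * y + 1)) + h (y / (y + 1))
  else h (1 + y / (y + 1)) + h (y / (y + 1))

/-- The mean of the kernel along the Farey path of `(1 + √5) / 2`. -/
def goldenMean (c : ℝ) : ℝ := 1 / (√5 - c)

/-- The mean of the kernel along the Farey path of `1 + √2`. -/
def silverMean (c : ℝ) : ℝ := (1 / (2 * √2 - c) + 1 / (3 / 2 * √2 - c)) / 2

theorem sqrt_five_bounds : 2.236 < √5 ∧ √5 < 2.2361 :=
  ⟨Real.lt_sqrt_of_sq_lt (by norm_num), (Real.sqrt_lt' (by norm_num)).2 (by norm_num)⟩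

theorem sqrt_two_bounds : 1.4142 < √2 ∧ √2 < 1.41422 :=
  ⟨Real.lt_sqrt_of_sq_lt (by norm_num), (Real.sqrt_lt' (by norm_num)).2 (by norm_num)⟩

/-- `(x + 1 / x) - (y + 1 / y)` factored. -/
theorem add_one_div_sub {x y : ℝ} (hx : x ≠ 0) (hy : y ≠ 0) :
    (x + 1 / x) - (y + 1 / y) = (x - y) * (1 - 1 / (x * y)) := by
  field_simp
  ring

theorem kernel_div_add_one (c : ℝ) {y : ℝ} (hy : 0 < y) :
    kernel c (y / (y + 1)) = kernel c (1 + 1 / y) := by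
  rw [← kernel_inv c (by positivity : 0 < 1 + 1 / y)]
  congr 1
  field_simp

theorem kernel_div_two_mul_add_one (c : ℝ) {y : ℝ} (hy : 0 < y) :
    kernel c (y / (2 * y + 1)) = kernel c (2 + 1 / y) := by
  rw [← kernel_inv c (by positivity : 0 < 2 + 1 / y)]
  congr 1
  field_simp

theorem golden_add_inv : (1 + √5) / 2 + 1 / ((1 + √5) / 2) = √5 := by
  have h5 : √5 ^ 2 = 5 := Real.sq_sqrt (by norm_num)
  have := sqrt_five_bounds
  field_simp
  nlinarith

theorem kernel_golden (c : ℝ) : kernel c ((1 + √5) / 2) = goldenMean c := by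
  rw [kernel_eq c (by positivity), golden_add_inv, goldenMean]

theorem blk_golden : blk false ((1 + √5) / 2) = (1 + √5) / 2 := by
  have h5 : √5 ^ 2 = 5 := Real.sq_sqrt (by norm_num)
  have hy : ((1 + √5) / 2) ^ 2 = (1 + √5) / 2 + 1 := by linear_combination h5 / 4
  have h0 : 0 < (1 + √5) / 2 := by positivity
  generalize (1 + √5) / 2 = y at *
  simp only [blk, Bool.false_eq_true, if_false]
  field_simp
  linear_combination -hy

theorem blk_silver : blk true (1 + √2) = 1 + √2 := by
  have h2 : √2 ^ 2 = 2 := Real.sq_sqrt (by norm_num)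
  have hy : (1 + √2) ^ 2 = 2 * (1 + √2) + 1 := by linear_combination h2
  have h0 : 0 < 1 + √2 := by positivity
  generalize 1 + √2 = y at *
  simp only [blk, if_true]
  field_simp
  linear_combination -2 * hy

theorem blkSum_golden (c : ℝ) : blkSum (kernel c) false ((1 + √5) / 2) = 2 * goldenMean c := by
  have h5 : √5 ^ 2 = 5 := Real.sq_sqrt (by norm_num)
  have e1 : 1 + (1 + √5) / 2 / ((1 + √5) / 2 + 1) = (1 + √5) / 2 := by
    have := blk_golden
    simpa [blk] using this
  have e2 : 1 + 1 / ((1 + √5) / 2) = (1 + √5) / 2 := by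
    field_simp
    nlinarith
  simp only [blkSum, Bool.false_eq_true, if_false]
  rw [e1, kernel_div_add_one c (by positivity), e2, kernel_golden]
  ring

theorem kernel_silver (c : ℝ) : kernel c (1 + √2) = 1 / (2 * √2 - c) := by
  have h2 : √2 ^ 2 = 2 := Real.sq_sqrt (by norm_num)
  rw [kernel_eq c (by positivity)]
  congr 2
  field_simp
  nlinarith

theorem kernel_sqrt_two (c : ℝ) : kernel c (√2) = 1 / (3 / 2 * √2 - c) := by
  have h2 : √2 ^ 2 = 2 := Real.sq_sqrt (by norm_num)
  rw [kernel_eq c (by positivity)]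
  congr 2
  field_simp
  nlinarith

/-- The four tails are `1 + √2`, `√2` and the inverses of these two numbers, and the kernel is
invariant under inversion. -/
theorem blkSum_silver (c : ℝ) : blkSum (kernel c) true (1 + √2) = 4 * silverMean c := by
  have h2 : √2 ^ 2 = 2 := Real.sq_sqrt (by norm_num)
  have e1 : 2 + (1 + √2) / (2 * (1 + √2) + 1) = 1 + √2 := by
    have := blk_silver
    simpa [blk] using this
  have e3 : 1 + (1 + √2) / (2 * (1 + √2) + 1) = √2 := by linarith
  have e2 : 1 / (1 + √2) = √2 - 1 := by
    field_simp
    nlinarith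
  have e4 : 2 + 1 / (1 + √2) = 1 + √2 := by rw [e2]; ring
  have e5 : 1 + 1 / (1 + √2) = √2 := by rw [e2]; ring
  simp only [blkSum, if_true]
  rw [e1, e3, kernel_div_add_one c (by positivity), kernel_div_two_mul_add_one c (by positivity), e4,
    e5, kernel_silver, kernel_sqrt_two, silverMean]
  ring

/-- The interval between the two extremal Markov irrationalities. -/
def markovInterval : Set ℝ := Set.Icc ((1 + √5) / 2) (1 + √2)

/-- Both maps are increasing; `blk false` fixes the left end and has values below 2, `blk true`
fixes the right end and has values above 2, and 2 lies inside the interval. -/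
theorem blk_mem_markovInterval (b : Bool) {y : ℝ} (hy : y ∈ markovInterval) :
    blk b y ∈ markovInterval := by
  obtain ⟨h1, h2⟩ := hy
  obtain ⟨f1, f2⟩ := sqrt_five_bounds
  obtain ⟨t1, t2⟩ := sqrt_two_bounds
  have hy0 : 1 < y := by linarith
  have g5 := blk_golden
  have g2 := blk_silver
  simp only [blk, markovInterval, Set.mem_Icc, if_true, Bool.false_eq_true, if_false] at *
  have m1 : ∀ a b : ℝ, 1 < a → a ≤ b → a / (a + 1) ≤ b / (b + 1) := fun a b ha hab => by
    rw [div_le_div_iff₀ (by linarith) (by linarith)]; nlinarith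
  have m2 : ∀ a b : ℝ, 1 < a → a ≤ b → a / (2 * a + 1) ≤ b / (2 * b + 1) := fun a b ha hab => by
    rw [div_le_div_iff₀ (by linarith) (by linarith)]; nlinarith
  have p1 : y / (y + 1) < 1 := by rw [div_lt_one (by linarith)]; linarith
  have p2 : 0 < y / (2 * y + 1) := by positivity
  cases b
  · simp only [Bool.false_eq_true, if_false]
    exact ⟨by linarith [m1 _ _ (by linarith) h1], by linarith⟩
  · simp only [if_true]
    exact ⟨by linarith, by linarith [m2 _ _ hy0 h2]⟩

/-! ### Bounds for block sums up to a potential -/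

/-- Linearizes `1 / (r + e)` at `r = √5 - c` uniformly in `c`: all estimates become multiples of `1
/ r²` and can be added. The claim `r² ≤ (r - e') (r + e)` amounts to `e e' ≤ r (e - e')`, which is
weakest for large `r`, so the least value `1.236` decides. -/
theorem one_div_le_of_shift {r e e' u : ℝ} (hr : 1.236 ≤ r) (he : -1.236 < e) (hu : r + e ≤ u)
    (h1 : e' ≤ e) (h2 : e * e' ≤ 1.236 * (e - e')) : 1 / u ≤ 1 / r - e' / r ^ 2 := by
  have hr0 : 0 < r := by linarith
  have hre : 0 < r + e := by linarith
  refine (one_div_le_one_div_of_le hre hu).trans ?_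
  have : 1 / r - e' / r ^ 2 = (r - e') / r ^ 2 := by
    field_simp
  rw [this, div_le_div_iff₀ hre (by positivity)]
  nlinarith

/-- The loss `Δ / (U (U + Δ))` is at most `Δ / U²`, and `m` converts `1 / U²` to the common unit `1
/ r²`. -/
theorem le_one_div_of_shift {r k m U Δ : ℝ} (hr : 0 < r) (hU : 0 < U) (hΔ : 0 ≤ Δ)
    (h1 : r ^ 2 ≤ m * U ^ 2) (h2 : Δ * m ≤ k) : 1 / U - k / r ^ 2 ≤ 1 / (U + Δ) := by
  have e : 1 / U - 1 / (U + Δ) = Δ / (U * (U + Δ)) := by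
    field_simp
    ring
  have : Δ / (U * (U + Δ)) ≤ k / r ^ 2 := by
    rw [div_le_div_iff₀ (by positivity) (by positivity)]
    have hk : 0 ≤ k := by
      have hm : 0 ≤ m := by
        by_contra h
        have : m * U ^ 2 < 0 := mul_neg_of_neg_of_pos (not_le.mp h) (by positivity)
        nlinarith [sq_nonneg r]
      exact (mul_nonneg hΔ hm).trans h2
    calc Δ * r ^ 2 ≤ Δ * (m * U ^ 2) := by gcongr
      _ = (Δ * m) * (U * U) := by ring
      _ ≤ k * (U * (U + Δ)) := by gcongr; linarith
  linarith

theorem add_one_div_mono {x y : ℝ} (hx : 1 ≤ x) (hxy : x ≤ y) : x + 1 / x ≤ y + 1 / y := by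
  have h := add_one_div_sub (x := y) (y := x) (by linarith) (by linarith)
  have : 1 / (y * x) ≤ 1 := by
    rw [div_le_one (by nlinarith)]
    nlinarith
  nlinarith [mul_nonneg (sub_nonneg.2 hxy) (sub_nonneg.2 this)]

/-- Elementary bounds for `y` in the Markov interval. -/
theorem markovInterval_bounds {y : ℝ} (hy : y ∈ markovInterval) :
    1.618 < y ∧ y < 2.41422 ∧ 0.414 < 1 / y ∧ 1 / y < 0.6181 := by
  obtain ⟨h1, h2⟩ := hy
  obtain ⟨f1, f2⟩ := sqrt_five_bounds
  obtain ⟨t1, t2⟩ := sqrt_two_bounds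
  have hy0 : 0 < y := by linarith
  refine ⟨by linarith, by linarith, ?_, ?_⟩
  · rw [lt_div_iff₀ hy0]; linarith
  · rw [div_lt_iff₀ hy0]; linarith

/-- Since `φ = 1 + 1/φ`, the difference `φ - (1 + 1/y)` is `(y - φ) / (φ y)`; the last factor comes
from `x + 1/x`. -/
theorem tail_one_le_golden {y : ℝ} (hy : y ∈ markovInterval) :
    √5 - (1 + 1 / y + 1 / (1 + 1 / y)) =
      (y - (1 + √5) / 2) * (1 / ((1 + √5) / 2 * y)) * (1 - 1 / ((1 + √5) / 2 * (1 + 1 / y))) := by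
  obtain ⟨b1, b2, b3, b4⟩ := markovInterval_bounds hy
  have h5 : √5 ^ 2 = 5 := Real.sq_sqrt (by norm_num)
  have e := add_one_div_sub (x := (1 + √5) / 2) (y := 1 + 1 / y) (by positivity) (by positivity)
  rw [golden_add_inv] at e
  rw [e]
  congr 1
  have hy : ((1 + √5) / 2) ^ 2 = (1 + √5) / 2 + 1 := by linear_combination h5 / 4
  have h0 : 0 < (1 + √5) / 2 := by positivity
  generalize (1 + √5) / 2 = p at *
  field_simp
  linear_combination y * hy

theorem tail_one_one_sub_golden {y : ℝ} (hy : y ∈ markovInterval) :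
    1 + y / (y + 1) - (1 + √5) / 2 = (y - (1 + √5) / 2) * (1 / ((1 + √5) / 2 + 1) * (1 / (y + 1))) := by
  obtain ⟨b1, b2, b3, b4⟩ := markovInterval_bounds hy
  have g := blk_golden
  simp only [blk, Bool.false_eq_true, if_false] at g
  have h0 : 0 < (1 + √5) / 2 := by positivity
  generalize (1 + √5) / 2 = p at *
  nth_rewrite 1 [← g]
  field_simp
  ring

/-- The tails of `[1; 1, y]` compared with the golden ratio. -/
theorem golden_tail_bounds {y : ℝ} (hy : y ∈ markovInterval) :
    0 ≤ 1 + y / (y + 1) - (1 + √5) / 2 ∧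
    1 + y / (y + 1) - (1 + √5) / 2 ≤ 0.15 * (y - (1 + √5) / 2) ∧
    √5 ≤ 1 + y / (y + 1) + 1 / (1 + y / (y + 1)) ∧
    1 + y / (y + 1) + 1 / (1 + y / (y + 1)) ≤ √5 + 0.1 * (y - (1 + √5) / 2) ∧
    0.14 * (y - (1 + √5) / 2) ≤ √5 - (1 + 1 / y + 1 / (1 + 1 / y)) ∧
    √5 - (1 + 1 / y + 1 / (1 + 1 / y)) ≤ 0.25 * (y - (1 + √5) / 2) := by
  obtain ⟨b1, b2, b3, b4⟩ := markovInterval_bounds hy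
  obtain ⟨f1, f2⟩ := sqrt_five_bounds
  have hyφ := hy.1
  have hD := tail_one_le_golden hy
  have hE := tail_one_one_sub_golden hy
  have hφ : 1.618 < (1 + √5) / 2 := by linarith
  have hφ2 : (1 + √5) / 2 < 1.6181 := by linarith
  have hg := golden_add_inv
  generalize (1 + √5) / 2 = p at *
  have hφy : 0 ≤ y - p := by linarith
  have w0 : 0 ≤ 1 / (p + 1) * (1 / (y + 1)) := by positivity
  have w1 : 1 / (p + 1) * (1 / (y + 1)) ≤ 0.15 := by
    rw [div_mul_div_comm, div_le_iff₀ (by positivity)]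
    nlinarith only [b1, hφ]
  have hA : 1 + y / (y + 1) - p ≤ 0.15 * (y - p) := by
    rw [hE, mul_comm]
    gcongr
  have hA0 : 0 ≤ 1 + y / (y + 1) - p := by
    rw [hE]
    exact mul_nonneg hφy w0
  have hF := add_one_div_sub (x := 1 + y / (y + 1)) (y := p) (by linarith) (by linarith)
  rw [hg] at hF
  have q1 : 1 / (p * y) ≤ 0.39 := by
    rw [div_le_iff₀ (by positivity)]
    nlinarith only [b1, hφ]
  have q1' : 0.25 ≤ 1 / (p * y) := by
    rw [le_div_iff₀ (by positivity)]
    nlinarith only [b1, hφ, b2, hφ2]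
  have q2 : 1 / (p * (1 + 1 / y)) ≤ 0.4372 := by
    rw [div_le_iff₀ (by positivity)]
    nlinarith only [b3, hφ]
  have q3 : 0.38 ≤ 1 / (p * (1 + 1 / y)) := by
    rw [le_div_iff₀ (by positivity)]
    nlinarith only [b3, b4, hφ, hφ2]
  have hu1 : 1 + y / (y + 1) ≤ 1.75 := by linarith
  have hu0 : 1.618 ≤ 1 + y / (y + 1) := by linarith
  have q4 : 0.34 ≤ 1 / ((1 + y / (y + 1)) * p) := by
    rw [le_div_iff₀ (by positivity)]
    nlinarith only [hu1, hu0, hφ, hφ2]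
  have q5 : 1 / ((1 + y / (y + 1)) * p) ≤ 1 := by
    rw [div_le_iff₀ (by positivity)]
    nlinarith only [hu1, hu0, hφ, hφ2]
  refine ⟨hA0, hA, ?_, ?_, ?_, ?_⟩
  · have := mul_nonneg hA0 (sub_nonneg.2 q5)
    linarith
  · have : (1 + y / (y + 1) - p) * (1 - 1 / ((1 + y / (y + 1)) * p)) ≤ (0.15 * (y - p)) * 0.66 :=
      mul_le_mul hA (by linarith) (by linarith) (by positivity)
    linarith
  · rw [hD]
    calc _ ≤ (y - p) * 0.25 * 0.5628 := by linarith
      _ ≤ _ := mul_le_mul (by gcongr) (by linarith) (by norm_num) (by positivity)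
  · rw [hD]
    calc _ ≤ (y - p) * 0.39 * 0.62 :=
          mul_le_mul (by gcongr) (by linarith) (by linarith) (by positivity)
      _ ≤ _ := by linarith

/-- The first tail satisfies `x + 1/x ≥ √5`, so its term is at most the golden one. The second falls
short of `√5` by at most a quarter of `y - φ`; the potential pays for it, because the block
contracts the distance to `φ` and so `y - blk false y` is at least `0.85 (y - φ)`. -/
theorem blkSum_false_le {c y : ℝ} (hc : |c| ≤ 1) (hy : y ∈ markovInterval) :
    blkSum (kernel c) false y ≤
      2 * goldenMean c + 0.4 / (√5 - c) ^ 2 * (y - blk false y) := by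
  obtain ⟨b1, b2, b3, b4⟩ := markovInterval_bounds hy
  obtain ⟨c1, c2⟩ := abs_le.mp hc
  obtain ⟨f1, f2⟩ := sqrt_five_bounds
  obtain ⟨g1, g2, g3, g4, g5, g6⟩ := golden_tail_bounds hy
  have hyφ := hy.1
  simp only [blkSum, blk, Bool.false_eq_true, if_false]
  rw [kernel_div_add_one c (by linarith), kernel_eq c (by positivity : 0 < 1 + y / (y + 1)),
    kernel_eq c (by positivity : 0 < 1 + 1 / y), goldenMean]
  have t1 : 1 / (1 + y / (y + 1) + 1 / (1 + y / (y + 1)) - c) ≤ 1 / (√5 - c) :=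
    one_div_le_one_div_of_le (by linarith) (by linarith)
  have t2 : 1 / (1 + 1 / y + 1 / (1 + 1 / y) - c) ≤
      1 / (√5 - c) + 0.4 / (√5 - c) ^ 2 * (y - (1 + y / (y + 1))) := by
    have hr1 : 1.236 ≤ √5 - c := by linarith
    have e1 : 1 + 1 / y + 1 / (1 + 1 / y) - c =
      (√5 - c) - (√5 - (1 + 1 / y + 1 / (1 + 1 / y))) := by ring
    rw [e1]
    have hd0 : 0 ≤ √5 - (1 + 1 / y + 1 / (1 + 1 / y)) := by linarith
    have hd2 : √5 - (1 + 1 / y + 1 / (1 + 1 / y)) ≤ 0.2 := by linarith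
    -- The factor `1.2` leaves room for the quadratic term of `1 / (r - d)`: it suffices that `1.2 d
    -- ≤ 0.2 r`, and this holds for `d ≤ 0.2` and `r ≥ 1.236`.
    have hd3 : 1.2 * (√5 - (1 + 1 / y + 1 / (1 + 1 / y))) ≤ 0.4 * (y - (1 + y / (y + 1))) := by
      linarith
    generalize √5 - (1 + 1 / y + 1 / (1 + 1 / y)) = d at *
    generalize y - (1 + y / (y + 1)) = s at *
    generalize √5 - c = r at *
    have hr0 : 0 < r := by linarith
    have e2 : 1 / r + 0.4 / r ^ 2 * s = (r + 0.4 * s) / r ^ 2 := by field_simp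
    rw [e2, div_le_div_iff₀ (by linarith) (by positivity)]
    have k1 : (r - d) * (1.2 * d) ≤ (r - d) * (0.4 * s) :=
      mul_le_mul_of_nonneg_left hd3 (by linarith)
    have k2 : d * (r * 0.2 - 1.2 * d) ≥ 0 := mul_nonneg hd0 (by linarith)
    nlinarith only [k1, k2]
  linarith

/-- Bounds for the tails that occur in a block `2, 2`. -/
theorem tail_two_bounds {y : ℝ} (hy : y ∈ markovInterval) :
    0.38 ≤ y / (2 * y + 1) ∧ y / (2 * y + 1) ≤ √2 - 1 := by
  have h := (blk_mem_markovInterval true hy).2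
  obtain ⟨b1, b2, b3, b4⟩ := markovInterval_bounds hy
  simp only [blk, if_true] at h
  refine ⟨?_, by linarith⟩
  rw [le_div_iff₀ (by linarith)]
  linarith

/-- Of the four values of `x + 1/x`, two are at least `2.8` and two at least `2.1`. In units of `1 /
(√5 - c)²` the large ones gain `0.385 + 0.39`, the small ones lose at most `0.16 + 0.14`, and the
potential costs at most `0.32`. -/
theorem blkSum_true_le {c y : ℝ} (hc : |c| ≤ 1) (hy : y ∈ markovInterval) :
    blkSum (kernel c) true y ≤
      4 * goldenMean c + 0.4 / (√5 - c) ^ 2 * (y - blk true y) := by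
  obtain ⟨b1, b2, b3, b4⟩ := markovInterval_bounds hy
  obtain ⟨c1, c2⟩ := abs_le.mp hc
  obtain ⟨f1, f2⟩ := sqrt_five_bounds
  obtain ⟨s1, s2⟩ := tail_two_bounds hy
  obtain ⟨m1, m2⟩ := blk_mem_markovInterval true hy
  obtain ⟨t1, t2⟩ := sqrt_two_bounds
  simp only [blk, if_true] at m1 m2
  simp only [blkSum, blk, if_true]
  rw [kernel_div_add_one c (by linarith), kernel_div_two_mul_add_one c (by linarith),
    kernel_eq c (by linarith), kernel_eq c (by linarith), kernel_eq c (by linarith),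
    kernel_eq c (by linarith), goldenMean]
  set r := √5 - c with hr
  have hr1 : 1.236 ≤ r := by linarith
  have a1 : 2.8 ≤ 2 + y / (2 * y + 1) + 1 / (2 + y / (2 * y + 1)) :=
    le_trans (by norm_num) (add_one_div_mono (x := 2.38) (by norm_num) (by linarith))
  have a2 : 2.1 ≤ 1 + y / (2 * y + 1) + 1 / (1 + y / (2 * y + 1)) :=
    le_trans (by norm_num) (add_one_div_mono (x := 1.38) (by norm_num) (by linarith))
  have a3 : 2.828 ≤ 2 + 1 / y + 1 / (2 + 1 / y) :=
    le_trans (by norm_num) (add_one_div_mono (x := 2.414) (by norm_num) (by linarith))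
  have a4 : 2.121 ≤ 1 + 1 / y + 1 / (1 + 1 / y) :=
    le_trans (by norm_num) (add_one_div_mono (x := 1.414) (by norm_num) (by linarith))
  have k1 : 1 / (2 + y / (2 * y + 1) + 1 / (2 + y / (2 * y + 1)) - c) ≤ 1 / r - 0.385 / r ^ 2 :=
    one_div_le_of_shift (e := 0.56) hr1 (by norm_num) (by linarith)
      (by norm_num) (by norm_num)
  have k2 : 1 / (1 + y / (2 * y + 1) + 1 / (1 + y / (2 * y + 1)) - c) ≤
      1 / r - (-0.16) / r ^ 2 :=
    one_div_le_of_shift (e := -0.14) hr1 (by norm_num) (by linarith)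
      (by norm_num) (by norm_num)
  have k3 : 1 / (2 + 1 / y + 1 / (2 + 1 / y) - c) ≤ 1 / r - 0.39 / r ^ 2 :=
    one_div_le_of_shift (e := 0.59) hr1 (by norm_num) (by linarith)
      (by norm_num) (by norm_num)
  have k4 : 1 / (1 + 1 / y + 1 / (1 + 1 / y) - c) ≤ 1 / r - (-0.14) / r ^ 2 :=
    one_div_le_of_shift (e := -0.12) hr1 (by norm_num) (by linarith)
      (by norm_num) (by norm_num)
  have key : -0.32 / r ^ 2 ≤ 0.4 / r ^ 2 * (y - (2 + y / (2 * y + 1))) := by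
    rw [div_mul_eq_mul_div]
    gcongr
    linarith
  have e : 4 * (1 / r) + -0.32 / r ^ 2 - ((1 / r - 0.385 / r ^ 2) + (1 / r - (-0.16) / r ^ 2) +
      (1 / r - 0.39 / r ^ 2) + (1 / r - (-0.14) / r ^ 2)) = 0.155 / r ^ 2 := by ring
  have : 0 ≤ 0.155 / r ^ 2 := by positivity
  linarith

/-- By convexity of `1 / x` the block sum is at least twice the golden mean. This exceeds twice the
silver mean by at least `0.272 / r²`, with `r = √5 - c`, while the potential takes at most `0.27 /
r²`. The margin is what limits the weight `0.37` from above. -/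
theorem le_blkSum_false {c y : ℝ} (hc : |c| ≤ 1) (hy : y ∈ markovInterval) :
    2 * silverMean c + 0.37 / (√5 - c) ^ 2 * (y - blk false y) ≤ blkSum (kernel c) false y := by
  obtain ⟨b1, b2, b3, b4⟩ := markovInterval_bounds hy
  obtain ⟨c1, c2⟩ := abs_le.mp hc
  obtain ⟨f1, f2⟩ := sqrt_five_bounds
  obtain ⟨t1, t2⟩ := sqrt_two_bounds
  have hyφ := hy.1
  obtain ⟨g1, g2, g3, g4, g5, g6⟩ := golden_tail_bounds hy
  simp only [blkSum, blk, Bool.false_eq_true, if_false]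
  rw [kernel_div_add_one c (by linarith), kernel_eq c (by positivity : 0 < 1 + y / (y + 1)),
    kernel_eq c (by positivity : 0 < 1 + 1 / y), silverMean]
  set r := √5 - c with hr
  have hr1 : 1.236 ≤ r := by linarith
  have conv : 2 * (1 / r) ≤ 1 / (1 + y / (y + 1) + 1 / (1 + y / (y + 1)) - c) +
      1 / (1 + 1 / y + 1 / (1 + 1 / y) - c) := by
    -- The excess of the first value over `√5` is at most `0.1 (y - φ)`, the deficit of the second
    -- at least `0.14 (y - φ)`.
    have hs : (1 + y / (y + 1) + 1 / (1 + y / (y + 1)) - c) +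
        (1 + 1 / y + 1 / (1 + 1 / y) - c) ≤ 2 * r := by linarith
    have h1 : 0 < 1 + y / (y + 1) + 1 / (1 + y / (y + 1)) - c := by linarith
    have h2 : 0 < 1 + 1 / y + 1 / (1 + 1 / y) - c := by linarith
    generalize 1 + y / (y + 1) + 1 / (1 + y / (y + 1)) - c = a at *
    generalize 1 + 1 / y + 1 / (1 + 1 / y) - c = b at *
    rw [div_add_div _ _ h1.ne' h2.ne', mul_one_div, div_le_div_iff₀ (by linarith) (by positivity)]
    have k : (a + b) * (a + b) ≤ (a + b) * (2 * r) := mul_le_mul_of_nonneg_left hs (by linarith)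
    linarith only [k, sq_nonneg (a - b)]
  have k1 : 1 / (2 * √2 - c) ≤ 1 / r - 0.4 / r ^ 2 :=
    one_div_le_of_shift (e := 0.592) hr1 (by norm_num) (by linarith)
      (by norm_num) (by norm_num)
  have k2 : 1 / (3 / 2 * √2 - c) ≤ 1 / r - (-0.128) / r ^ 2 :=
    one_div_le_of_shift (e := -0.115) hr1 (by norm_num) (by linarith)
      (by norm_num) (by norm_num)
  have hy2 : y - (1 + y / (y + 1)) ≤ 0.72 := by
    have : y - 1 - 0.72 ≤ y / (y + 1) := by
      rw [le_div_iff₀ (by linarith)]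
      nlinarith only [b1, b2]
    linarith
  have key : 0.37 / r ^ 2 * (y - (1 + y / (y + 1))) ≤ 0.27 / r ^ 2 := by
    rw [div_mul_eq_mul_div]
    gcongr
    linarith
  have e : 2 * (1 / r) - (0.27 / r ^ 2 + (1 / r - 0.4 / r ^ 2) + (1 / r - (-0.128) / r ^ 2)) =
      0.002 / r ^ 2 := by ring
  have : 0 ≤ 0.002 / r ^ 2 := by positivity
  linarith

/-- The tails of `[2; 2, y]` compared with those of `1 + √2`. -/
theorem silver_tail_bounds {y : ℝ} (hy : y ∈ markovInterval) :
    1 + √2 - (2 + y / (2 * y + 1)) ≤ 0.05 * (1 + √2 - y) ∧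
    0 ≤ (2 + 1 / y + 1 / (2 + 1 / y)) - 2 * √2 ∧
    (2 + 1 / y + 1 / (2 + 1 / y)) - 2 * √2 ≤ 0.216 * (1 + √2 - y) ∧
    0 ≤ (1 + 1 / y + 1 / (1 + 1 / y)) - 3 / 2 * √2 ∧
    (1 + 1 / y + 1 / (1 + 1 / y)) - 3 / 2 * √2 ≤ 0.1443 * (1 + √2 - y) := by
  obtain ⟨b1, b2, b3, b4⟩ := markovInterval_bounds hy
  obtain ⟨t1, t2⟩ := sqrt_two_bounds
  have h2 : √2 ^ 2 = 2 := Real.sq_sqrt (by norm_num)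
  have hyψ : 0 ≤ 1 + √2 - y := by linarith [hy.2]
  have uψ : (1 + √2) + 1 / (1 + √2) = 2 * √2 := by
    field_simp
    linear_combination -h2
  have us : √2 + 1 / √2 = 3 / 2 * √2 := by
    field_simp
    linear_combination -h2
  have g := blk_silver
  simp only [blk, if_true] at g
  generalize √2 = s at *
  have inv : 1 / y - (s - 1) = (1 + s - y) * (1 / y * (s - 1)) := by
    field_simp
    linear_combination -h2
  have w : 1 / y * (s - 1) ≤ 0.2561 := by nlinarith only [b3, b4, t1, t2]
  have inv2 : 1 / y - (s - 1) ≤ (1 + s - y) * 0.2561 := by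
    rw [inv]
    gcongr
  have inv0 : 0 ≤ 1 / y - (s - 1) := by
    rw [inv]
    exact mul_nonneg hyψ (mul_nonneg (by positivity) (by linarith))
  have a3 := add_one_div_sub (x := 2 + 1 / y) (y := 1 + s) (by linarith) (by linarith)
  have a4 := add_one_div_sub (x := 1 + 1 / y) (y := s) (by linarith) (by linarith)
  rw [uψ] at a3
  rw [us] at a4
  have hB : 1 / ((2 * (1 + s) + 1) * (2 * y + 1)) ≤ 0.05 := by
    rw [div_le_iff₀ (by positivity)]
    nlinarith only [b1, t1]
  have eB : 1 + s - (2 + y / (2 * y + 1)) =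
      (1 + s - y) * (1 / ((2 * (1 + s) + 1) * (2 * y + 1))) := by
    nth_rewrite 1 [← g]
    field_simp
    ring
  have hy0 : 0 < 1 / y := by linarith
  generalize 1 / y = z at *
  have q3 : 0.158 ≤ 1 / ((2 + z) * (1 + s)) := by
    rw [le_div_iff₀ (by positivity)]
    nlinarith only [b3, b4, t1, t2]
  have q3' : 1 / ((2 + z) * (1 + s)) ≤ 1 := by
    rw [div_le_iff₀ (by positivity)]
    nlinarith only [b3, b4, t1, t2]
  have q4 : 0.4369 ≤ 1 / ((1 + z) * s) := by
    rw [le_div_iff₀ (by positivity)]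
    nlinarith only [b3, b4, t1, t2]
  have q4' : 1 / ((1 + z) * s) ≤ 1 := by
    rw [div_le_iff₀ (by positivity)]
    nlinarith only [b3, b4, t1, t2]
  refine ⟨?_, ?_, ?_, ?_, ?_⟩
  · rw [eB, mul_comm]
    gcongr
  · rw [a3]
    exact mul_nonneg (by linarith) (by linarith)
  · rw [a3]
    calc _ ≤ ((1 + s - y) * 0.2561) * 0.842 :=
          mul_le_mul (by linarith) (by linarith) (by linarith) (by positivity)
      _ ≤ _ := by linarith
  · rw [a4]
    exact mul_nonneg (by linarith) (by linarith)
  · rw [a4]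
    calc _ ≤ ((1 + s - y) * 0.2561) * 0.5631 :=
          mul_le_mul (by linarith) (by linarith) (by linarith) (by positivity)
      _ ≤ _ := by linarith

/-- The comparison is sharp at `y = ψ`, so every error has to be linear in `ψ - y`. The first two
tails only help. The last two lose `0.72 * 0.216 + 1.22 * 0.1443 < 0.332` in units of `(ψ - y) / (√5
- c)²`, and the potential returns at least `0.37 * 0.95 > 0.35`. -/
theorem le_blkSum_true {c y : ℝ} (hc : |c| ≤ 1) (hy : y ∈ markovInterval) :
    4 * silverMean c + 0.37 / (√5 - c) ^ 2 * (y - blk true y) ≤ blkSum (kernel c) true y := by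
  obtain ⟨b1, b2, b3, b4⟩ := markovInterval_bounds hy
  obtain ⟨c1, c2⟩ := abs_le.mp hc
  obtain ⟨f1, f2⟩ := sqrt_five_bounds
  obtain ⟨s1, s2⟩ := tail_two_bounds hy
  obtain ⟨t1, t2⟩ := sqrt_two_bounds
  obtain ⟨hB, d3', d3, d4', d4⟩ := silver_tail_bounds hy
  have h2 : √2 ^ 2 = 2 := Real.sq_sqrt (by norm_num)
  have hyψ : 0 ≤ 1 + √2 - y := by linarith [hy.2]
  simp only [blkSum, blk, if_true]
  rw [kernel_div_add_one c (by linarith), kernel_div_two_mul_add_one c (by linarith),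
    kernel_eq c (by linarith), kernel_eq c (by linarith), kernel_eq c (by linarith),
    kernel_eq c (by linarith), silverMean]
  have k1 : 1 / (2 * √2 - c) ≤ 1 / (2 + y / (2 * y + 1) + 1 / (2 + y / (2 * y + 1)) - c) := by
    have l1 : 2.1 ≤ 2 + y / (2 * y + 1) + 1 / (2 + y / (2 * y + 1)) :=
      le_trans (by norm_num) (add_one_div_mono (x := 2) (by norm_num) (by linarith))
    have a1 := add_one_div_mono (x := 2 + y / (2 * y + 1)) (y := 1 + √2) (by linarith) (by linarith)
    have uψ : (1 + √2) + 1 / (1 + √2) = 2 * √2 := by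
      field_simp
      linear_combination -h2
    rw [uψ] at a1
    exact one_div_le_one_div_of_le (by linarith) (by linarith)
  have k2 : 1 / (3 / 2 * √2 - c) ≤
      1 / (1 + y / (2 * y + 1) + 1 / (1 + y / (2 * y + 1)) - c) := by
    have l2 : 2.001 ≤ 1 + y / (2 * y + 1) + 1 / (1 + y / (2 * y + 1)) :=
      le_trans (by norm_num) (add_one_div_mono (x := 1.1) (by norm_num) (by linarith))
    have a2 := add_one_div_mono (x := 1 + y / (2 * y + 1)) (y := √2) (by linarith) (by linarith)
    have us : √2 + 1 / √2 = 3 / 2 * √2 := by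
      field_simp
      linear_combination -h2
    rw [us] at a2
    exact one_div_le_one_div_of_le (by linarith) (by linarith)
  have hr1 : 1.236 ≤ √5 - c := by linarith
  have hr2 : √5 - c ≤ 3.2361 := by linarith
  have k3 : 1 / (2 * √2 - c) - (0.72 * (0.216 * (1 + √2 - y))) / (√5 - c) ^ 2 ≤
      1 / (2 + 1 / y + 1 / (2 + 1 / y) - c) := by
    have e : 2 + 1 / y + 1 / (2 + 1 / y) - c =
      (2 * √2 - c) + ((2 + 1 / y + 1 / (2 + 1 / y)) - 2 * √2) := by ring
    rw [e]
    refine le_one_div_of_shift (m := 0.72) (by linarith) (by linarith) d3' ?_ (by linarith)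
    -- The ratio `r / (r + 0.592)` is largest at the upper end `r = 3.2361`, where its square is
    -- below `0.72`. For the other tail `r / (r - 0.115)` is largest at `r = 1.236`, with square
    -- below `1.22`.
    have : √5 - c + 0.592 ≤ 2 * √2 - c := by linarith
    nlinarith only [this, hr1, hr2]
  have k4 : 1 / (3 / 2 * √2 - c) - (1.22 * (0.1443 * (1 + √2 - y))) / (√5 - c) ^ 2 ≤
      1 / (1 + 1 / y + 1 / (1 + 1 / y) - c) := by
    have e : 1 + 1 / y + 1 / (1 + 1 / y) - c =
      (3 / 2 * √2 - c) + ((1 + 1 / y + 1 / (1 + 1 / y)) - 3 / 2 * √2) := by ring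
    rw [e]
    refine le_one_div_of_shift (m := 1.22) (by linarith) (by linarith) d4' ?_ (by linarith)
    have : √5 - c - 0.115 ≤ 3 / 2 * √2 - c := by linarith
    nlinarith only [this, hr1, hr2]
  have key : 0.37 / (√5 - c) ^ 2 * (y - (2 + y / (2 * y + 1))) ≤
      -(0.35 * (1 + √2 - y)) / (√5 - c) ^ 2 := by
    rw [div_mul_eq_mul_div]
    gcongr
    linarith
  have e : 0.35 * (1 + √2 - y) / (√5 - c) ^ 2 -
      ((0.72 * (0.216 * (1 + √2 - y))) / (√5 - c) ^ 2 +
      (1.22 * (0.1443 * (1 + √2 - y))) / (√5 - c) ^ 2) =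
      0.018434 * ((1 + √2 - y) / (√5 - c) ^ 2) := by ring
  have : 0 ≤ 0.018434 * ((1 + √2 - y) / (√5 - c) ^ 2) := by positivity
  have e' : -(0.35 * (1 + √2 - y)) / (√5 - c) ^ 2 =
    -(0.35 * (1 + √2 - y) / (√5 - c) ^ 2) := by ring
  linarith

/-! ### Tails of Farey paths -/

open scoped Classical in
/-- The first letter of the Farey path of `x` is removed: `V⁻¹` is applied if `x < 1`, and `T⁻¹`
otherwise. -/
def fareyStep (x : ℝ) : ℝ := if x < 1 then x / (1 - x) else x - 1

open scoped Classical in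
/-- The past `X_n ⋯ X_1 η` of the Farey path of `x`. -/
def fareyPast (x η : ℝ) : ℕ → ℝ
  | 0 => η
  | n + 1 => letterAct (fareyStep^[n] x < 1) (fareyPast x η n)

open scoped Classical in
theorem fareyPast_succ' (x η : ℝ) (n : ℕ) :
    fareyPast x η (n + 1) = fareyPast (fareyStep x) (letterAct (x < 1) η) n := by
  induction n with
  | zero => rfl
  | succ n ih =>
    rw [fareyPast, ih, fareyPast]
    congr 2

theorem fareyPast_pos (x : ℝ) {η : ℝ} (hη : 0 < η) (n : ℕ) : 0 < fareyPast x η n := by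
  induction n with
  | zero => exact hη
  | succ n ih => exact letterAct_pos _ ih

theorem fareyStep_of_one_le {x : ℝ} (hx : 1 ≤ x) : fareyStep x = x - 1 := by
  rw [fareyStep, if_neg (not_lt.mpr hx)]

theorem fareyStep_div_add_one {x : ℝ} (hx : 0 < x) : fareyStep (x / (x + 1)) = x := by
  rw [fareyStep, if_pos (by rw [div_lt_one (by linarith)]; linarith)]
  field_simp
  ring

theorem fareyStep_add {n x : ℝ} (hn : 1 ≤ n) (hx : 0 ≤ x) : fareyStep (n + x) = n + x - 1 :=
  fareyStep_of_one_le (by linarith)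

theorem fareyStep_div_two_mul {y : ℝ} (hy : 0 < y) :
    fareyStep (y / (2 * y + 1)) = y / (y + 1) := by
  have : y / (2 * y + 1) = y / (y + 1) / (y / (y + 1) + 1) := by
    field_simp
    ring
  rw [this, fareyStep_div_add_one (by positivity)]

theorem fareyStep_blk_false {y : ℝ} (hy : 0 < y) : fareyStep (blk false y) = y / (y + 1) := by
  simp only [blk, Bool.false_eq_true, if_false]
  rw [fareyStep_add le_rfl (by positivity)]
  ring

theorem fareyStep_blk_true {y : ℝ} (hy : 0 < y) :
    fareyStep (blk true y) = 1 + y / (2 * y + 1) := by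
  simp only [blk, if_true]
  rw [fareyStep_add (by norm_num) (by positivity)]
  ring

theorem fareyStep_one_add {y : ℝ} (hy : 0 < y) :
    fareyStep (1 + y / (2 * y + 1)) = y / (2 * y + 1) := by
  rw [fareyStep_add (by norm_num) (by positivity)]
  ring

theorem blk_pos (b : Bool) {y : ℝ} (hy : 0 < y) : 1 < blk b y := by
  unfold blk
  split_ifs
  · linarith [show 0 < y / (2 * y + 1) by positivity]
  · linarith [show 0 < y / (y + 1) by positivity]

/-- The tail of the path after a block. -/
theorem fareyStep_iterate_blk (b : Bool) {y : ℝ} (hy : 0 < y) (n : ℕ) :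
    fareyStep^[n + blkLen b] (blk b y) = fareyStep^[n] y := by
  rw [Function.iterate_add_apply]
  congr 1
  cases b
  · simp only [blkLen, Bool.false_eq_true, if_false, Function.iterate_succ, Function.comp,
      Function.iterate_zero, id, fareyStep_blk_false hy, fareyStep_div_add_one hy]
  · simp only [blkLen, if_true, Function.iterate_succ, Function.comp, Function.iterate_zero, id,
      fareyStep_blk_true hy, fareyStep_one_add hy, fareyStep_div_two_mul hy,
      fareyStep_div_add_one hy]

theorem sum_range_blk (h : ℝ → ℝ) (b : Bool) {y : ℝ} (hy : 0 < y) (n : ℕ) :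
    ∑ k ∈ Finset.range (n + blkLen b), h (fareyStep^[k] (blk b y)) =
      blkSum h b y + ∑ k ∈ Finset.range n, h (fareyStep^[k] y) := by
  rw [add_comm n, Finset.sum_range_add]
  congr 1
  · cases b
    · simp only [blkLen, Bool.false_eq_true, if_false, Finset.sum_range_succ,
        Finset.sum_range_zero, zero_add, Function.iterate_succ, Function.comp,
        Function.iterate_zero, id, fareyStep_blk_false hy, blkSum]
      simp [blk]
    · simp only [blkLen, if_true, Finset.sum_range_succ, Finset.sum_range_zero, zero_add,
        Function.iterate_succ, Function.comp, Function.iterate_zero, id,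
        fareyStep_blk_true hy, fareyStep_one_add hy, fareyStep_div_two_mul hy, blkSum]
      simp [blk]
  · refine Finset.sum_congr rfl fun k _ => ?_
    rw [add_comm, fareyStep_iterate_blk b hy]

theorem not_blk_lt_one (b : Bool) {y : ℝ} (hy : 0 < y) : ¬ blk b y < 1 :=
  not_lt.mpr (blk_pos b hy).le

theorem div_add_one_lt_one {y : ℝ} (hy : 0 < y) : y / (y + 1) < 1 := by
  rw [div_lt_one (by linarith)]; linarith

theorem div_two_mul_lt_one {y : ℝ} (hy : 0 < y) : y / (2 * y + 1) < 1 := by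
  rw [div_lt_one (by linarith)]; linarith

/-- The letters of a block, applied to the past. -/
theorem fareyPast_blk_false {y : ℝ} (hy : 0 < y) {η : ℝ} (hη : 0 < η) (n : ℕ) :
    fareyPast (blk false y) η⁻¹ 1 = (η / (η + 1))⁻¹ ∧
    fareyPast (blk false y) η⁻¹ (n + 2) = fareyPast y (blk false η)⁻¹ n := by
  have e1 : letterAct (blk false y < 1) η⁻¹ = (η / (η + 1))⁻¹ := by
    rw [letterAct, if_neg (not_blk_lt_one _ hy)]
    field_simp
    ring
  constructor
  · rw [fareyPast_succ', e1]
    rfl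
  · rw [fareyPast_succ', fareyPast_succ', e1, fareyStep_blk_false hy, fareyStep_div_add_one hy]
    congr 1
    rw [letterAct, if_pos (div_add_one_lt_one hy)]
    simp only [blk, Bool.false_eq_true, if_false]
    field_simp
    ring

theorem fareyPast_blk_true {y : ℝ} (hy : 0 < y) {η : ℝ} (hη : 0 < η) (n : ℕ) :
    fareyPast (blk true y) η⁻¹ 1 = (η / (η + 1))⁻¹ ∧
    fareyPast (blk true y) η⁻¹ 2 = (η / (2 * η + 1))⁻¹ ∧
    fareyPast (blk true y) η⁻¹ 3 = (1 + η / (2 * η + 1))⁻¹ ∧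
    fareyPast (blk true y) η⁻¹ (n + 4) = fareyPast y (blk true η)⁻¹ n := by
  have e1 : letterAct (blk true y < 1) η⁻¹ = (η / (η + 1))⁻¹ := by
    rw [letterAct, if_neg (not_blk_lt_one _ hy)]
    field_simp
    ring
  have p0 : 0 < y / (2 * y + 1) := by positivity
  have e2 : letterAct (1 + y / (2 * y + 1) < 1) (η / (η + 1))⁻¹ = (η / (2 * η + 1))⁻¹ := by
    rw [letterAct, if_neg (by linarith)]
    field_simp
    ring
  have e3 : letterAct (y / (2 * y + 1) < 1) (η / (2 * η + 1))⁻¹ = (1 + η / (2 * η + 1))⁻¹ := by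
    rw [letterAct, if_pos (div_two_mul_lt_one hy)]
    field_simp
    ring
  refine ⟨?_, ?_, ?_, ?_⟩
  · rw [fareyPast_succ', e1]
    rfl
  · rw [fareyPast_succ', fareyPast_succ', e1, fareyStep_blk_true hy, e2]
    rfl
  · rw [fareyPast_succ', fareyPast_succ', fareyPast_succ', e1, fareyStep_blk_true hy, e2,
      fareyStep_one_add hy, e3]
    rfl
  · rw [fareyPast_succ', fareyPast_succ', fareyPast_succ', fareyPast_succ', e1,
      fareyStep_blk_true hy, e2, fareyStep_one_add hy, e3, fareyStep_div_two_mul hy,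
      fareyStep_div_add_one hy]
    congr 1
    rw [letterAct, if_pos (div_add_one_lt_one hy)]
    simp only [blk, if_true]
    field_simp
    ring

/-- Inversion exchanges `T` and `V`, and both `TV` and `TTVV` become themselves when reversed with
the letters exchanged. Hence the past runs through the inverses of the tails of `blk b η`, and the
same block inequalities serve for past and future. -/
theorem sum_range_fareyPast_blk (h : ℝ → ℝ) (hinv : ∀ x, 0 < x → h x⁻¹ = h x) (b : Bool) {y η : ℝ}
    (hy : 0 < y) (hη : 0 < η) (n : ℕ) :
    ∑ k ∈ Finset.range (n + blkLen b), h (fareyPast (blk b y) η⁻¹ (k + 1)) =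
      blkSum h b η + ∑ k ∈ Finset.range n, h (fareyPast y (blk b η)⁻¹ (k + 1)) := by
  have hb := blk_pos b hη
  rw [add_comm n, Finset.sum_range_add]
  congr 1
  · cases b
    · simp only [blkLen, Bool.false_eq_true, if_false, Finset.sum_range_succ,
        Finset.sum_range_zero, zero_add, (fareyPast_blk_false hy hη 0).1, Nat.reduceAdd,
        (fareyPast_blk_false hy hη 0).2]
      rw [fareyPast, hinv _ (by positivity), hinv _ (by linarith)]
      simp only [blk, blkSum, Bool.false_eq_true, if_false]
      ring
    · obtain ⟨e1, e2, e3, e4⟩ := fareyPast_blk_true hy hη 0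
      simp only [zero_add] at e4
      simp only [blkLen, if_true, Finset.sum_range_succ,
        Finset.sum_range_zero, zero_add, Nat.reduceAdd, e1, e2, e3, e4]
      rw [fareyPast, hinv _ (by positivity), hinv _ (by positivity), hinv _ (by positivity),
        hinv _ (by linarith)]
      simp only [blk, blkSum, if_true]
      ring
  · refine Finset.sum_congr rfl fun k _ => ?_
    cases b
    · rw [← (fareyPast_blk_false hy hη (k + 1)).2]
      congr 2
      simp [blkLen]
      ring
    · rw [← (fareyPast_blk_true hy hη (k + 1)).2.2.2]
      congr 2
      simp [blkLen]
      ring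

/-! ### Averages along paths that are composed of blocks -/

/-- `P` is a set of positive reals in `S`, each of which is `blk b y` with `b ∈ B` and `y` in `P`;
the set `S` is invariant under the blocks in `B`. -/
structure BlockSystem (P S : Set ℝ) (B : Set Bool) : Prop where
  exists_eq : ∀ x ∈ P, ∃ b ∈ B, ∃ y ∈ P, x = blk b y
  subset : P ⊆ S
  pos : ∀ x ∈ S, 0 < x
  blk_mem : ∀ b ∈ B, ∀ x ∈ S, blk b x ∈ S

theorem abs_sum_range_le {u : ℕ → ℝ} (hu : ∀ k, |u k| ≤ 1) (n : ℕ) :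
    |∑ k ∈ Finset.range n, u k| ≤ n := by
  refine (Finset.abs_sum_le_sum_abs _ _).trans ?_
  refine (Finset.sum_le_sum fun k _ => hu k).trans ?_
  simp

theorem BlockSystem.iterate_pos {P S : Set ℝ} {B : Set Bool} (hs : BlockSystem P S B) {x : ℝ}
    (hx : x ∈ P) (n : ℕ) : 0 < fareyStep^[n] x := by
  induction n using Nat.strong_induction_on generalizing x with
  | _ n ih =>
    obtain ⟨b, -, y, hy, rfl⟩ := hs.exists_eq x hx
    have hy0 := hs.pos y (hs.subset hy)
    rcases le_or_gt (blkLen b) n with hn | hn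
    · obtain ⟨m, rfl⟩ := Nat.exists_eq_add_of_le' hn
      rw [fareyStep_iterate_blk b hy0]
      exact ih m (by cases b <;> simp [blkLen]) hy
    · cases b
      · have : n = 0 ∨ n = 1 := by simp [blkLen] at hn; omega
        rcases this with rfl | rfl
        · exact zero_lt_one.trans (blk_pos _ hy0)
        · simp only [Function.iterate_one, fareyStep_blk_false hy0]; positivity
      · have : n = 0 ∨ n = 1 ∨ n = 2 ∨ n = 3 := by simp [blkLen] at hn; omega
        rcases this with rfl | rfl | rfl | rfl
        · exact zero_lt_one.trans (blk_pos _ hy0)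
        all_goals
          simp only [Function.iterate_succ, Function.iterate_zero, Function.comp, id,
            fareyStep_blk_true hy0, fareyStep_one_add hy0, fareyStep_div_two_mul hy0]
          positivity

theorem blkLen_le (b : Bool) : blkLen b ≤ 4 := by cases b <;> simp [blkLen]

theorem blkLen_pos (b : Bool) : 0 < blkLen b := by cases b <;> simp [blkLen]

theorem sum_le_of_small {u : ℕ → ℝ} (hu : ∀ k, |u k| ≤ 1) {n : ℕ} (hn : n ≤ 4) {H : ℝ}
    (hH : |H| ≤ 1) : ∑ k ∈ Finset.range n, u k ≤ n * H + 8 := by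
  have h1 := (abs_le.mp (abs_sum_range_le hu n)).2
  have h2 := (abs_le.mp hH).1
  have h3 : (n : ℝ) ≤ 4 := by exact_mod_cast hn
  have h4 : (0 : ℝ) ≤ n := n.cast_nonneg
  nlinarith

/-- The sum over the tails of a path is bounded by means of a potential `G`. -/
theorem BlockSystem.sum_tail_le {P S : Set ℝ} {B : Set Bool} (hs : BlockSystem P S B)
    {h G : ℝ → ℝ} {H C : ℝ} (hh : ∀ x, 0 < x → |h x| ≤ 1) (hH : |H| ≤ 1) (hG : ∀ x ∈ S, G x ≤ C)
    (hineq : ∀ b ∈ B, ∀ y ∈ S, blkSum h b y ≤ blkLen b * H + (G y - G (blk b y)))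
    {x : ℝ} (hx : x ∈ P) (n : ℕ) :
    ∑ k ∈ Finset.range n, h (fareyStep^[k] x) ≤ n * H + (8 + C - G x) := by
  induction n using Nat.strong_induction_on generalizing x with
  | _ n ih =>
    -- A remainder of at most four terms is estimated trivially, which is the source of the constant
    -- 8; otherwise the first block is split off and its coboundary telescopes.
    rcases le_or_gt n 4 with hn | hn
    · have := sum_le_of_small (fun k => hh _ (hs.iterate_pos hx k)) hn hH
      linarith [hG x (hs.subset hx)]
    · obtain ⟨b, hb, y, hy, rfl⟩ := hs.exists_eq x hx
      have hy0 := hs.pos y (hs.subset hy)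
      obtain ⟨m, rfl⟩ := Nat.exists_eq_add_of_le' ((blkLen_le b).trans hn.le)
      rw [sum_range_blk h b hy0]
      have h1 := ih m (by have := blkLen_pos b; omega) hy
      have h2 := hineq b hb y (hs.subset hy)
      push_cast
      linarith

/-- The sum over the past of a path is bounded by means of a potential `G`. -/
theorem BlockSystem.sum_past_le {P S : Set ℝ} {B : Set Bool} (hs : BlockSystem P S B)
    {h G : ℝ → ℝ} {H : ℝ} (hh : ∀ x, 0 < x → |h x| ≤ 1) (hinv : ∀ x, 0 < x → h x⁻¹ = h x)
    (hH : |H| ≤ 1) (hG : ∀ x ∈ S, 0 ≤ G x)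
    (hineq : ∀ b ∈ B, ∀ y ∈ S, blkSum h b y ≤ blkLen b * H + (G y - G (blk b y)))
    {x η : ℝ} (hx : x ∈ P) (hη : η ∈ S) (n : ℕ) :
    ∑ k ∈ Finset.range n, h (fareyPast x η⁻¹ (k + 1)) ≤ n * H + (8 + G η) := by
  induction n using Nat.strong_induction_on generalizing x η with
  | _ n ih =>
    have hη0 := hs.pos η hη
    rcases le_or_gt n 4 with hn | hn
    · have := sum_le_of_small
        (fun k => hh _ (fareyPast_pos x (inv_pos.mpr hη0) (k + 1))) hn hH
      linarith [hG η hη]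
    · obtain ⟨b, hb, y, hy, rfl⟩ := hs.exists_eq x hx
      have hy0 := hs.pos y (hs.subset hy)
      obtain ⟨m, rfl⟩ := Nat.exists_eq_add_of_le' ((blkLen_le b).trans hn.le)
      rw [sum_range_fareyPast_blk h hinv b hy0 hη0]
      have h1 := ih m (by have := blkLen_pos b; omega) hy (hs.blk_mem b hb η hη)
      have h2 := hineq b hb η hη
      push_cast
      linarith

/-! ### The matrices along a Farey path -/

theorem det_eq_one (A : SL(2, ℤ)) : A 0 0 * A 1 1 - A 0 1 * A 1 0 = 1 := by
  have h := A.det_coe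
  rwa [Matrix.det_fin_two] at h

theorem mul_matT_apply (A : SL(2, ℤ)) :
    (A * matT) 0 0 = A 0 0 ∧ (A * matT) 0 1 = A 0 0 + A 0 1 ∧
    (A * matT) 1 0 = A 1 0 ∧ (A * matT) 1 1 = A 1 0 + A 1 1 := by
  have e : ((A * matT : SL(2, ℤ)) : Matrix (Fin 2) (Fin 2) ℤ) =
      (A : Matrix (Fin 2) (Fin 2) ℤ) * !![1, 1; 0, 1] := Matrix.SpecialLinearGroup.coe_mul A matT
  rw [e]
  refine ⟨?_, ?_, ?_, ?_⟩ <;> simp [Matrix.mul_apply, Fin.sum_univ_two]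

theorem mul_matV_apply (A : SL(2, ℤ)) :
    (A * matV) 0 0 = A 0 0 + A 0 1 ∧ (A * matV) 0 1 = A 0 1 ∧
    (A * matV) 1 0 = A 1 0 + A 1 1 ∧ (A * matV) 1 1 = A 1 1 := by
  have e : ((A * matV : SL(2, ℤ)) : Matrix (Fin 2) (Fin 2) ℤ) =
      (A : Matrix (Fin 2) (Fin 2) ℤ) * !![1, 0; 1, 1] := Matrix.SpecialLinearGroup.coe_mul A matV
  rw [e]
  refine ⟨?_, ?_, ?_, ?_⟩ <;> simp [Matrix.mul_apply, Fin.sum_univ_two]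

/-- The Möbius transformation `A` maps the real number `u` to the real number `w`. -/
def MapsReal (A : SL(2, ℤ)) (u w : ℝ) : Prop :=
  (A 0 0 : ℝ) * u + A 0 1 = w * (A 1 0 * u + A 1 1)

open scoped Classical in
/-- The matrix `V` or `T`. -/
def letterMatrix (b : Prop) : SL(2, ℤ) := if b then matV else matT

open scoped Classical in
theorem mapsReal_mul_letterMatrix (A : SL(2, ℤ)) (b : Prop) {u w : ℝ} (hu : 0 < u) :
    MapsReal (A * letterMatrix b) u w ↔ MapsReal A (letterAct b u) w := by
  by_cases hb : b
  · simp only [letterMatrix, letterAct, hb, if_true, MapsReal]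
    obtain ⟨e1, e2, e3, e4⟩ := mul_matV_apply A
    rw [e1, e2, e3, e4]
    push_cast
    have : 0 < 1 + u := by linarith
    rw [← mul_right_inj' this.ne']
    field_simp
    constructor <;> intro h <;> linear_combination h
  · simp only [letterMatrix, letterAct, hb, if_false, MapsReal]
    obtain ⟨e1, e2, e3, e4⟩ := mul_matT_apply A
    rw [e1, e2, e3, e4]
    push_cast
    constructor <;> intro h <;> linear_combination h

-- For `L = T` or `V` one has `L⁻¹ (-v) = -(L v)`. So the repelling fixed point, when carried back
-- along the path, collects letters instead of losing them: this is the past.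
open scoped Classical in
theorem mapsReal_mul_letterMatrix_neg (A : SL(2, ℤ)) (b : Prop) {v w : ℝ} (hv : 0 < v)
    (h : MapsReal A (-v) w) : MapsReal (A * letterMatrix b) (-letterAct b v) w := by
  by_cases hb : b
  · simp only [letterMatrix, letterAct, hb, if_true, MapsReal] at h ⊢
    obtain ⟨e1, e2, e3, e4⟩ := mul_matV_apply A
    rw [e1, e2, e3, e4]
    push_cast
    have : 0 < 1 + v := by linarith
    field_simp
    linear_combination h
  · simp only [letterMatrix, letterAct, hb, if_false, MapsReal] at h ⊢
    obtain ⟨e1, e2, e3, e4⟩ := mul_matT_apply A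
    rw [e1, e2, e3, e4]
    push_cast
    linear_combination h

/-- The entries of a product of matrices `T` and `V`. -/
def IsPositive (A : SL(2, ℤ)) : Prop := 1 ≤ A 0 0 ∧ 0 ≤ A 0 1 ∧ 0 ≤ A 1 0 ∧ 1 ≤ A 1 1

theorem IsPositive.mul_letterMatrix {A : SL(2, ℤ)} (hA : IsPositive A) (b : Prop) :
    IsPositive (A * letterMatrix b) := by
  obtain ⟨h1, h2, h3, h4⟩ := hA
  unfold IsPositive letterMatrix
  split_ifs
  · obtain ⟨e1, e2, e3, e4⟩ := mul_matV_apply A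
    rw [e1, e2, e3, e4]
    exact ⟨by omega, by omega, by omega, by omega⟩
  · obtain ⟨e1, e2, e3, e4⟩ := mul_matT_apply A
    rw [e1, e2, e3, e4]
    exact ⟨by omega, by omega, by omega, by omega⟩

/-- A matrix of determinant 1 with these signs is increasing on the positive reals, and `x = A u` is
compared with `A 1`. -/
theorem lt_fareyFraction_iff {A : SL(2, ℤ)} (hA : IsPositive A) {u x : ℝ} (hu : 0 < u)
    (h : MapsReal A u x) : x < fareyFraction A ↔ u < 1 := by
  obtain ⟨h1, h2, h3, h4⟩ := hA
  have hdet : (A 0 0 : ℝ) * A 1 1 - A 0 1 * A 1 0 = 1 := by exact_mod_cast det_eq_one A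
  have h3' : (0 : ℝ) ≤ A 1 0 := by exact_mod_cast h3
  have h4' : (1 : ℝ) ≤ A 1 1 := by exact_mod_cast h4
  have d1 : 0 < (A 1 0 : ℝ) * u + A 1 1 := by positivity
  have d2 : 0 < (A 1 0 : ℝ) + A 1 1 := by positivity
  have hx : x = ((A 0 0 : ℝ) * u + A 0 1) / (A 1 0 * u + A 1 1) := by
    rw [eq_div_iff d1.ne']
    exact h.symm
  rw [fareyFraction]
  push_cast
  rw [hx, div_lt_div_iff₀ d1 d2, ← sub_pos]
  have : ((A 0 0 : ℝ) + A 0 1) * (A 1 0 * u + A 1 1) - (A 0 0 * u + A 0 1) * (A 1 0 + A 1 1) =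
      1 - u := by linear_combination (1 - u) * hdet
  rw [this, sub_pos]

open scoped Classical in
theorem letterAct_fareyStep {u : ℝ} (hu : 0 < u) : letterAct (u < 1) (fareyStep u) = u := by
  unfold letterAct fareyStep
  split_ifs with h
  · have : 0 < 1 - u := by linarith
    field_simp
    ring
  · ring

/-- Identifies the Farey path with the orbit of `x` under `fareyStep`: `A_n` maps the `n`-th tail to
`x`, hence the next letter is decided by comparing that tail with 1. -/
theorem fareyMatrix_spec {x : ℝ} (hx : ∀ n, 0 < fareyStep^[n] x) (n : ℕ) :
    IsPositive (fareyMatrix x n) ∧ MapsReal (fareyMatrix x n) (fareyStep^[n] x) x ∧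
    fareyMatrix x (n + 1) = fareyMatrix x n * letterMatrix (fareyStep^[n] x < 1) := by
  have step : ∀ n, IsPositive (fareyMatrix x n) →
      MapsReal (fareyMatrix x n) (fareyStep^[n] x) x →
      fareyMatrix x (n + 1) = fareyMatrix x n * letterMatrix (fareyStep^[n] x < 1) := by
    intro n h1 h2
    rw [fareyMatrix, letterMatrix]
    simp only [lt_fareyFraction_iff h1 (hx n) h2]
    split_ifs <;> rfl
  have key : IsPositive (fareyMatrix x n) ∧ MapsReal (fareyMatrix x n) (fareyStep^[n] x) x := by
    induction n with
    | zero => simp [IsPositive, MapsReal, fareyMatrix]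
    | succ n ih =>
      have e := step n ih.1 ih.2
      refine ⟨e ▸ ih.1.mul_letterMatrix _, ?_⟩
      rw [e, mapsReal_mul_letterMatrix _ _ (hx (n + 1)), Function.iterate_succ_apply',
        letterAct_fareyStep (hx n)]
      exact ih.2
  exact ⟨key.1, key.2, step n key.1 key.2⟩

theorem isHyperbolic_of_pos {A : SL(2, ℤ)} (h1 : 1 ≤ A 0 1) (h2 : 1 ≤ A 1 0) :
    (A : Matrix (Fin 2) (Fin 2) ℤ).IsHyperbolic := by
  have hdet := det_eq_one A
  simp only [Matrix.IsHyperbolic, Matrix.discr_fin_two, Matrix.trace_fin_two, Matrix.det_fin_two]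
  have : 0 < A 0 1 * A 1 0 := by positivity
  nlinarith [sq_nonneg (A 0 0 - A 1 1)]

/-- Once both letters have occurred, the off-diagonal entries are positive, and they stay so. -/
theorem fareyMatrix_isHyperbolic {x : ℝ} (hx : ∀ n, 0 < fareyStep^[n] x) {i j : ℕ}
    (hi : fareyStep^[i] x < 1) (hj : 1 ≤ fareyStep^[j] x) {n : ℕ} (hin : i < n) (hjn : j < n) :
    (fareyMatrix x n : Matrix (Fin 2) (Fin 2) ℤ).IsHyperbolic := by
  have hV : ∀ m, i < m → 1 ≤ fareyMatrix x m 1 0 := by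
    intro m hm
    induction m, hm using Nat.le_induction with
    | base =>
      obtain ⟨⟨h1, h2, h3, h4⟩, -, h⟩ := fareyMatrix_spec hx i
      rw [Nat.succ_eq_add_one, h, letterMatrix, if_pos hi, (mul_matV_apply _).2.2.1]
      omega
    | succ m _ ih =>
      obtain ⟨⟨h1, h2, h3, h4⟩, -, h⟩ := fareyMatrix_spec hx m
      rw [h, letterMatrix]
      split_ifs
      · rw [(mul_matV_apply _).2.2.1]; omega
      · rw [(mul_matT_apply _).2.2.1]; omega
  have hT : ∀ m, j < m → 1 ≤ fareyMatrix x m 0 1 := by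
    intro m hm
    induction m, hm using Nat.le_induction with
    | base =>
      obtain ⟨⟨h1, h2, h3, h4⟩, -, h⟩ := fareyMatrix_spec hx j
      rw [Nat.succ_eq_add_one, h, letterMatrix, if_neg (not_lt.mpr hj), (mul_matT_apply _).2.1]
      omega
    | succ m _ ih =>
      obtain ⟨⟨h1, h2, h3, h4⟩, -, h⟩ := fareyMatrix_spec hx m
      rw [h, letterMatrix]
      split_ifs
      · rw [(mul_matV_apply _).2.1]; omega
      · rw [(mul_matT_apply _).2.1]; omega
  exact isHyperbolic_of_pos (hT n hjn) (hV n hin)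

theorem IsFixedPoint.mapsReal {A : SL(2, ℤ)} {w : ℝ} (h : IsFixedPoint A w) : MapsReal A w w := by
  obtain ⟨h1, h2⟩ := h
  rw [div_eq_iff h1] at h2
  exact h2

/-- The fixed points of a positive hyperbolic matrix, and the form attached to it. -/
theorem exists_fixedPoints {A : SL(2, ℤ)} (hpos : IsPositive A)
    (hA : (A : Matrix (Fin 2) (Fin 2) ℤ).IsHyperbolic) :
    ∃ w' v : ℝ, 0 < w' ∧ 0 < v ∧ MapsReal A w' w' ∧ MapsReal A (-v) (-v) ∧
      ∀ z : ℂ, 0 < z.im → (Real.sqrt (formDiscr A) : ℂ) / formEval A z =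
        1 / (z + v) - 1 / (z - w') := by
  obtain ⟨-, w', w, hw', hw, hQw, hQw', hsgn⟩ := formCoeff_spec A hA
  obtain ⟨h1, h2, h3, h4⟩ := hpos
  have m' := hw'.1.mapsReal
  have m := hw.1.mapsReal
  have a' := hw'.2
  have a := hw.2
  have hdet : (A 0 0 : ℝ) * A 1 1 - A 0 1 * A 1 0 = 1 := by exact_mod_cast det_eq_one A
  have hdisc : (4 : ℝ) < (A 0 0 + A 1 1) ^ 2 := by
    have h := hA
    simp only [Matrix.IsHyperbolic, Matrix.discr_fin_two, Matrix.trace_fin_two,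
      Matrix.det_fin_two] at h
    have h' : 4 < (A 0 0 + A 1 1) ^ 2 := by linarith [det_eq_one A]
    exact_mod_cast h'
  have hne : w ≠ w' := by
    rintro rfl
    linarith
  have h1' : (1 : ℝ) ≤ A 0 0 := by exact_mod_cast h1
  have h2' : (0 : ℝ) ≤ A 0 1 := by exact_mod_cast h2
  have h3' : (0 : ℝ) ≤ A 1 0 := by exact_mod_cast h3
  have h4' : (1 : ℝ) ≤ A 1 1 := by exact_mod_cast h4
  rw [abs_of_nonneg (by positivity)] at a a'
  have l' : 1 < ((A 1 0 : ℝ) * w' + A 1 1) ^ 2 := by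
    have h0 : 0 < ((A 1 0 : ℝ) * w' + A 1 1) ^ 2 := by
      have := hw'.1.1
      positivity
    by_contra! h
    exact absurd ((one_le_inv₀ h0).mpr h) (not_le.mpr a')
  have l : ((A 1 0 : ℝ) * w + A 1 1) ^ 2 < 1 := by
    by_contra! h
    exact absurd (inv_le_one_of_one_le₀ h) (not_le.mpr a)
  unfold MapsReal at m m'
  -- Vieta
  have hsum : (A 1 0 : ℝ) * (w + w') = A 0 0 - A 1 1 := by
    have : (w - w') * ((A 1 0 : ℝ) * (w + w') - (A 0 0 - A 1 1)) = 0 := by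
      linear_combination m' - m
    rcases mul_eq_zero.mp this with h | h
    · exact absurd (sub_eq_zero.mp h) hne
    · linarith
  have hprod : (A 1 0 : ℝ) * (w * w') = -A 0 1 := by linear_combination m' + w' * hsum
  have hγ : (0 : ℝ) < A 1 0 := by
    refine lt_of_le_of_ne h3' fun h => ?_
    rw [← h] at hsum hdet
    have : (A 0 0 : ℝ) = A 1 1 := by linarith
    rw [this] at hdet hdisc
    nlinarith
  have hβ : (0 : ℝ) < A 0 1 := by
    refine lt_of_le_of_ne h2' fun h => ?_
    rw [← h] at hdet
    have e1 : (A 0 0 : ℝ) ≤ 1 := by nlinarith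
    have e2 : (A 1 1 : ℝ) ≤ 1 := by nlinarith
    nlinarith
  have hlt : w < w' := by
    have e : ((A 1 0 : ℝ) * w' + A 1 1) ^ 2 - ((A 1 0 : ℝ) * w + A 1 1) ^ 2 =
        (A 1 0 * (A 0 0 + A 1 1)) * (w' - w) := by
      linear_combination (A 1 0 * (w' - w)) * hsum
    have : 0 < (A 1 0 * (A 0 0 + A 1 1)) * (w' - w) := by linarith
    linarith [(mul_pos_iff_of_pos_left (by positivity)).mp this]
  have hww : w * w' < 0 := by
    by_contra! h
    have := mul_nonneg h3' h
    linarith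
  have hw'0 : 0 < w' := by
    by_contra! h
    nlinarith
  have hw0 : w < 0 := by
    by_contra! h
    nlinarith
  refine ⟨w', -w, hw'0, by linarith, hw'.1.mapsReal, by simpa using hw.1.mapsReal, ?_⟩
  intro z hz
  have hF1 : ((formCoeff A).1 : ℝ) < 0 := by
    rw [sign_neg (by linarith : w - w' < 0)] at hsgn
    exact sign_eq_neg_one_iff.mp hsgn
  have hFb : ((formCoeff A).2.1 : ℝ) = -((formCoeff A).1 * (w + w')) := by
    have : (w - w') * (((formCoeff A).1 : ℝ) * (w + w') + (formCoeff A).2.1) = 0 := by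
      linear_combination hQw - hQw'
    rcases mul_eq_zero.mp this with h | h
    · exact absurd (sub_eq_zero.mp h) hne
    · linarith
  have hFc : ((formCoeff A).2.2 : ℝ) = (formCoeff A).1 * (w * w') := by
    linear_combination hQw - w * hFb
  -- Both factors are negative, so this is the positive root; here the sign convention for `a`
  -- enters.
  have hD : Real.sqrt (formDiscr A) = (formCoeff A).1 * (w - w') := by
    have : ((formDiscr A : ℤ) : ℝ) = ((formCoeff A).1 * (w - w')) ^ 2 := by
      rw [formDiscr]
      push_cast
      rw [hFb, hFc]
      ring
    rw [this, Real.sqrt_sq]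
    nlinarith
  have hE : formEval A z = (formCoeff A).1 * ((z - w) * (z - w')) := by
    have hFb' : ((formCoeff A).2.1 : ℂ) = -((formCoeff A).1 * (w + w')) := by exact_mod_cast hFb
    have hFc' : ((formCoeff A).2.2 : ℂ) = (formCoeff A).1 * (w * w') := by exact_mod_cast hFc
    rw [formEval, hFb', hFc']
    ring
  have hz1 : z - w ≠ 0 := by
    intro h
    have := congrArg Complex.im h
    simp at this
    linarith
  have hz2 : z - w' ≠ 0 := by
    intro h
    have := congrArg Complex.im h
    simp at this
    linarith
  have hF0 : ((formCoeff A).1 : ℂ) ≠ 0 := by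
    have := hF1.ne
    exact_mod_cast this
  rw [hE, hD]
  push_cast
  rw [← sub_eq_add_neg]
  field_simp
  ring

/-! ### Cycle integrals as integrals along the arc -/

/-- The Möbius transformation of `ℂ` given by `A`. -/
def moebius (A : SL(2, ℤ)) (z : ℂ) : ℂ := (A 0 0 * z + A 0 1) / (A 1 0 * z + A 1 1)

theorem coe_smul_eq_moebius (A : SL(2, ℤ)) (τ : ℍ) : ((A • τ : ℍ) : ℂ) = moebius A τ := by
  rw [UpperHalfPlane.coe_specialLinearGroup_apply]
  simp [moebius]

theorem coe_ofComplex {z : ℂ} (hz : 0 < z.im) : ((ofComplex z : ℍ) : ℂ) = z := by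
  rw [ofComplex_apply_of_im_pos hz]

theorem moebius_eq_coe (A : SL(2, ℤ)) {z : ℂ} (hz : 0 < z.im) :
    moebius A z = ((A • (ofComplex z) : ℍ) : ℂ) := by
  rw [coe_smul_eq_moebius, coe_ofComplex hz]

theorem moebius_im_pos (A : SL(2, ℤ)) {z : ℂ} (hz : 0 < z.im) : 0 < (moebius A z).im := by
  rw [moebius_eq_coe A hz]
  exact (A • (ofComplex z)).im_pos

theorem apply_ofComplex_moebius {f : ℍ → ℂ} (hf : ∀ (γ : SL(2, ℤ)) (τ : ℍ), f (γ • τ) = f τ)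
    (A : SL(2, ℤ)) {z : ℂ} (hz : 0 < z.im) : f (ofComplex (moebius A z)) = f (ofComplex z) := by
  rw [moebius_eq_coe A hz, ofComplex_apply, hf]

theorem moebius_denom_ne_zero (A : SL(2, ℤ)) {z : ℂ} (hz : 0 < z.im) :
    (A 1 0 : ℂ) * z + A 1 1 ≠ 0 := by
  intro h
  have him := congrArg Complex.im h
  have hre := congrArg Complex.re h
  simp at him hre
  rcases him with h0 | h0
  · have hdet := det_eq_one A
    rw [h0] at hre hdet
    simp at hre
    rw [hre] at hdet
    simp at hdet
  · exact hz.ne' h0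

theorem det_eq_one_complex (A : SL(2, ℤ)) : (A 0 0 : ℂ) * A 1 1 - A 0 1 * A 1 0 = 1 := by
  exact_mod_cast det_eq_one A

theorem hasDerivAt_moebius (A : SL(2, ℤ)) {z : ℂ} (hz : 0 < z.im) :
    HasDerivAt (moebius A) (1 / ((A 1 0 : ℂ) * z + A 1 1) ^ 2) z := by
  have hd := moebius_denom_ne_zero A hz
  have h1 : HasDerivAt (fun z : ℂ => (A 0 0 : ℂ) * z + A 0 1) (A 0 0) z := by
    simpa using ((hasDerivAt_id z).const_mul (A 0 0 : ℂ)).add_const (A 0 1 : ℂ)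
  have h2 : HasDerivAt (fun z : ℂ => (A 1 0 : ℂ) * z + A 1 1) (A 1 0) z := by
    simpa using ((hasDerivAt_id z).const_mul (A 1 0 : ℂ)).add_const (A 1 1 : ℂ)
  refine (h1.div h2 hd).congr_deriv ?_
  congr 1
  linear_combination det_eq_one_complex A

theorem sub_ofReal_ne_zero {z : ℂ} (hz : 0 < z.im) (u : ℝ) : z - u ≠ 0 := by
  intro h
  have := congrArg Complex.im h
  simp at this
  exact hz.ne' this

theorem add_ofReal_ne_zero {z : ℂ} (hz : 0 < z.im) (u : ℝ) : z + u ≠ 0 := by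
  have := sub_ofReal_ne_zero hz (-u)
  simpa using this

/-- The differential `dz / (z + v) - dz / (z - w)` is transformed by moving its poles. -/
theorem moebius_differential {A : SL(2, ℤ)} {w v u p : ℝ} (h1 : MapsReal A u w)
    (h2 : MapsReal A (-p) (-v)) {z : ℂ} (hz : 0 < z.im) :
    (1 / (moebius A z + v) - 1 / (moebius A z - w)) * (1 / ((A 1 0 : ℂ) * z + A 1 1) ^ 2) =
      1 / (z + p) - 1 / (z - u) := by
  have hd := moebius_denom_ne_zero A hz
  have hm := moebius_im_pos A hz
  have n1 := add_ofReal_ne_zero hm v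
  have n2 := sub_ofReal_ne_zero hm w
  have n3 := add_ofReal_ne_zero hz p
  have n4 := sub_ofReal_ne_zero hz u
  have hdet := det_eq_one_complex A
  unfold MapsReal at h1 h2
  have h1' : (A 0 0 : ℂ) * u + A 0 1 = w * (A 1 0 * u + A 1 1) := by exact_mod_cast h1
  have h2' : (A 0 0 : ℂ) * (-p) + A 0 1 = -v * (A 1 0 * (-p) + A 1 1) := by exact_mod_cast h2
  unfold moebius at n1 n2 ⊢
  generalize (A 0 0 : ℂ) = α at *
  generalize (A 0 1 : ℂ) = β at *
  generalize (A 1 0 : ℂ) = γ at *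
  generalize (A 1 1 : ℂ) = δ at *
  have hdiv : (α * z + β) / (γ * z + δ) * (γ * z + δ) = α * z + β := div_mul_cancel₀ _ hd
  have e1 : ((α * z + β) / (γ * z + δ) + v) * ((γ * z + δ) * (δ - γ * p)) = z + p := by
    linear_combination (δ - γ * p) * hdiv + (z + p) * hdet + (γ * z + δ) * h2'
  have e2 : ((α * z + β) / (γ * z + δ) - w) * ((γ * z + δ) * (γ * u + δ)) = z - u := by
    linear_combination (γ * u + δ) * hdiv + (z - u) * hdet + (γ * z + δ) * h1'
  have r1 : 1 / ((α * z + β) / (γ * z + δ) + v) = ((γ * z + δ) * (δ - γ * p)) / (z + p) := by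
    rw [div_eq_div_iff n1 n3]
    linear_combination -e1
  have r2 : 1 / ((α * z + β) / (γ * z + δ) - w) = ((γ * z + δ) * (γ * u + δ)) / (z - u) := by
    rw [div_eq_div_iff n2 n4]
    linear_combination -e2
  rw [r1, r2]
  field_simp
  ring

/-- `e^{it}`. -/
def arc (t : ℝ) : ℂ := Complex.exp (t * Complex.I)

theorem arc_eq (t : ℝ) : arc t = (Real.cos t : ℂ) + Real.sin t * Complex.I := by
  rw [arc, Complex.exp_mul_I, Complex.ofReal_cos, Complex.ofReal_sin]

theorem arc_re (t : ℝ) : (arc t).re = Real.cos t := Complex.exp_ofReal_mul_I_re t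

theorem arc_im (t : ℝ) : (arc t).im = Real.sin t := Complex.exp_ofReal_mul_I_im t

theorem sin_pos_of_mem_arc {t : ℝ} (ht : t ∈ Set.Icc (Real.pi / 3) (2 * Real.pi / 3)) :
    0 < Real.sin t :=
  Real.sin_pos_of_pos_of_lt_pi (by linarith [ht.1, Real.pi_pos]) (by linarith [ht.2, Real.pi_pos])

theorem arc_im_pos {t : ℝ} (ht : t ∈ Set.Icc (Real.pi / 3) (2 * Real.pi / 3)) :
    0 < (arc t).im := by
  rw [arc_im]
  exact sin_pos_of_mem_arc ht

theorem abs_two_cos_le_one {t : ℝ} (ht : t ∈ Set.Icc (Real.pi / 3) (2 * Real.pi / 3)) :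
    |2 * Real.cos t| ≤ 1 := by
  have h1 : Real.cos t ≤ 1 / 2 := by
    rw [← Real.cos_pi_div_three]
    exact Real.cos_le_cos_of_nonneg_of_le_pi (by positivity) (by linarith [ht.2, Real.pi_pos]) ht.1
  have h2 : -(1 / 2) ≤ Real.cos t := by
    rw [← Real.cos_pi_div_three, ← Real.cos_pi_sub]
    exact Real.cos_le_cos_of_nonneg_of_le_pi (by linarith [ht.1, Real.pi_pos])
      (by linarith [Real.pi_pos]) (by linarith [ht.2])
  rw [abs_le]
  constructor <;> linarith

theorem hasDerivAt_arc (t : ℝ) : HasDerivAt arc (Complex.I * arc t) t := by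
  have h1 : HasDerivAt (fun t : ℝ => (t : ℂ) * Complex.I) Complex.I t := by
    simpa using (Complex.ofRealCLM.hasDerivAt (x := t)).mul_const Complex.I
  refine h1.cexp.congr_deriv ?_
  rw [arc]
  ring

theorem arc_pi_div_three : arc (Real.pi / 3) = 1 / 2 + √3 / 2 * Complex.I := by
  rw [arc_eq, Real.cos_pi_div_three, Real.sin_pi_div_three]
  push_cast
  ring

theorem arc_two_pi_div_three : arc (2 * Real.pi / 3) = -(1 / 2) + √3 / 2 * Complex.I := by
  have e : 2 * Real.pi / 3 = Real.pi - Real.pi / 3 := by ring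
  rw [arc_eq, e, Real.cos_pi_sub, Real.sin_pi_sub, Real.cos_pi_div_three, Real.sin_pi_div_three]
  push_cast
  ring

/-- Both `T` and `V` map the left end of the arc to the right end. -/
theorem moebius_mul_letterMatrix (A : SL(2, ℤ)) (b : Prop) :
    moebius (A * letterMatrix b) (arc (2 * Real.pi / 3)) = moebius A (arc (Real.pi / 3)) := by
  have h3 : (√3 : ℂ) ^ 2 = 3 := by
    have : (√3 : ℝ) ^ 2 = 3 := Real.sq_sqrt (by norm_num)
    exact_mod_cast this
  have hρ : arc (2 * Real.pi / 3) = arc (Real.pi / 3) - 1 := by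
    rw [arc_two_pi_div_three, arc_pi_div_three]
    ring
  have hsq : arc (Real.pi / 3) ^ 2 = arc (Real.pi / 3) - 1 := by
    rw [arc_pi_div_three]
    linear_combination Complex.I ^ 2 / 4 * h3 + 3 / 4 * Complex.I_sq
  have him : 0 < (arc (Real.pi / 3)).im :=
    arc_im_pos ⟨le_rfl, by linarith [Real.pi_pos]⟩
  have hd := moebius_denom_ne_zero A him
  have h0 : arc (Real.pi / 3) ≠ 0 := fun h => by simp [h] at him
  rw [hρ]
  generalize arc (Real.pi / 3) = ρ at *
  unfold letterMatrix moebius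
  split_ifs
  · obtain ⟨e1, e2, e3, e4⟩ := mul_matV_apply A
    rw [e1, e2, e3, e4]
    push_cast
    -- For `V`, the relation `ρ² = ρ - 1` produces a common factor `ρ` in numerator and denominator.
    have k1 : ((A 0 0 : ℂ) + A 0 1) * (ρ - 1) + A 0 1 = ρ * (A 0 0 * ρ + A 0 1) := by
      linear_combination -(A 0 0 : ℂ) * hsq
    have k2 : ((A 1 0 : ℂ) + A 1 1) * (ρ - 1) + A 1 1 = ρ * (A 1 0 * ρ + A 1 1) := by
      linear_combination -(A 1 0 : ℂ) * hsq
    rw [k1, k2, mul_div_mul_left _ _ h0]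
  · obtain ⟨e1, e2, e3, e4⟩ := mul_matT_apply A
    rw [e1, e2, e3, e4]
    push_cast
    congr 1 <;> ring

/-- The origin of the kernel: `|e^{it} - u|² = u² - 2 u cos t + 1`. -/
theorem re_I_mul_arc_div (t u : ℝ) :
    (Complex.I * arc t / (arc t - u)).re = Real.sin t * kernel (2 * Real.cos t) u := by
  have hn : Complex.normSq (arc t - u) = u ^ 2 - 2 * Real.cos t * u + 1 := by
    rw [Complex.normSq_apply]
    simp [arc_re, arc_im]
    linear_combination Real.sin_sq_add_cos_sq t
  rw [Complex.div_re, hn, kernel]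
  simp [arc_re, arc_im]
  ring

/-- The values of `f` on the arc. -/
def arcValue (f : ℍ → ℂ) (t : ℝ) : ℝ := (f (ofComplex (arc t))).re

theorem continuousOn_arcValue {f : ℍ → ℂ} (hf : MDiff f) :
    ContinuousOn (arcValue f) (Set.Icc (Real.pi / 3) (2 * Real.pi / 3)) := by
  have h := (UpperHalfPlane.mdifferentiable_iff.mp hf).continuousOn
  have harc : ContinuousOn arc (Set.Icc (Real.pi / 3) (2 * Real.pi / 3)) :=
    fun t _ => (hasDerivAt_arc t).continuousAt.continuousWithinAt
  exact Complex.continuous_re.comp_continuousOn (h.comp harc fun t ht => arc_im_pos ht)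

theorem IsNonnegOnArc.apply_eq {f : ℍ → ℂ} (hpos : IsNonnegOnArc f) {t : ℝ}
    (ht : t ∈ Set.Icc (Real.pi / 3) (2 * Real.pi / 3)) :
    f (ofComplex (arc t)) = arcValue f t ∧ 0 ≤ arcValue f t := by
  obtain ⟨h1, h2⟩ := hpos t ht (ofComplex (arc t)) (coe_ofComplex (arc_im_pos ht))
  exact ⟨Complex.ext rfl (by simpa using h1), h2⟩

theorem continuousOn_kernel_two_cos {u : ℝ} (s : ℝ) (hs : |s| = 1) :
    ContinuousOn (fun t => kernel (s * (2 * Real.cos t)) u)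
      (Set.Icc (Real.pi / 3) (2 * Real.pi / 3)) := by
  unfold kernel
  refine ContinuousOn.div (by fun_prop) (by fun_prop) fun t ht => ?_
  refine (kernel_denom_pos ?_ u).ne'
  rw [abs_mul, hs, one_mul]
  exact abs_two_cos_le_one ht

/-- The contribution of the image of the arc under `A`. -/
theorem re_primitive_sub {f : ℍ → ℂ} (hf : IsWeaklyHolomorphicModularFunction f)
    (hpos : IsNonnegOnArc f) {P : ℂ → ℂ} {w v : ℝ}
    (hP : ∀ z : ℂ, 0 < z.im → HasDerivAt P (f (ofComplex z) * (1 / (z + v) - 1 / (z - w))) z)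
    {A : SL(2, ℤ)} {u p : ℝ} (h1 : MapsReal A u w) (h2 : MapsReal A (-p) (-v)) :
    (P (moebius A (arc (Real.pi / 3)))).re - (P (moebius A (arc (2 * Real.pi / 3)))).re =
      ∫ t in (Real.pi / 3)..(2 * Real.pi / 3), arcValue f t * Real.sin t *
        (kernel (2 * Real.cos t) u + kernel (-(2 * Real.cos t)) p) := by
  have hle : Real.pi / 3 ≤ 2 * Real.pi / 3 := by linarith [Real.pi_pos]
  -- The Farey path traverses the arc from `2π/3` to `π/3`, against the parameter; this is the minus
  -- sign.
  have hderiv : ∀ t ∈ Set.uIcc (Real.pi / 3) (2 * Real.pi / 3),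
      HasDerivAt (fun t => -(P (moebius A (arc t))).re) (arcValue f t * Real.sin t *
        (kernel (2 * Real.cos t) u + kernel (-(2 * Real.cos t)) p)) t := by
    intro t ht
    rw [Set.uIcc_of_le hle] at ht
    have hz := arc_im_pos ht
    have d1 := (hP _ (moebius_im_pos A hz)).comp _ (hasDerivAt_moebius A hz)
    have d2 := d1.scomp t (hasDerivAt_arc t)
    have d3 := (Complex.reCLM.hasFDerivAt.comp_hasDerivAt t d2).neg
    refine d3.congr_deriv ?_
    rw [apply_ofComplex_moebius hf.invariant A hz, mul_assoc, moebius_differential h1 h2 hz,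
      (hpos.apply_eq ht).1]
    have e : (Complex.I * arc t) • ((arcValue f t : ℂ) * (1 / (arc t + p) - 1 / (arc t - u))) =
        (arcValue f t : ℂ) * (Complex.I * arc t / (arc t - ((-p : ℝ) : ℂ)) -
          Complex.I * arc t / (arc t - u)) := by
      rw [smul_eq_mul]
      push_cast
      rw [sub_neg_eq_add]
      ring
    rw [e, Complex.reCLM_apply, Complex.re_ofReal_mul, Complex.sub_re, re_I_mul_arc_div,
      re_I_mul_arc_div]
    have : kernel (2 * Real.cos t) (-p) = -kernel (-(2 * Real.cos t)) p := by
      rw [kernel, kernel, neg_div]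
      congr 2
      ring
    rw [this]
    ring
  rw [intervalIntegral.integral_eq_sub_of_hasDerivAt hderiv]
  · ring
  · refine ContinuousOn.intervalIntegrable ?_
    rw [Set.uIcc_of_le hle]
    have k1 := continuousOn_kernel_two_cos (u := u) 1 (by simp)
    have k2 := continuousOn_kernel_two_cos (u := p) (-1) (by simp)
    simp only [one_mul, neg_one_mul] at k1 k2
    exact ((continuousOn_arcValue hf.holomorphic).mul Real.continuous_sin.continuousOn).mul
      (k1.add k2)

/-- The cycle integral in terms of a primitive of the integrand. -/
theorem cycleIntegral_eq_primitive_sub {f : ℍ → ℂ} (hf : IsWeaklyHolomorphicModularFunction f)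
    (τ₀ : ℍ) {A : SL(2, ℤ)} (hA : (A : Matrix (Fin 2) (Fin 2) ℤ).IsHyperbolic) {w v : ℝ}
    (hw : MapsReal A w w) (hv : MapsReal A (-v) (-v))
    (hQ : ∀ z : ℂ, 0 < z.im → (Real.sqrt (formDiscr A) : ℂ) / formEval A z =
        1 / (z + v) - 1 / (z - w)) :
    ∃ P : ℂ → ℂ,
      (∀ z : ℂ, 0 < z.im → HasDerivAt P (f (ofComplex z) * (1 / (z + v) - 1 / (z - w))) z) ∧
      ∀ z : ℂ, 0 < z.im → cycleIntegral f τ₀ A = P (moebius A z) - P z := by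
  have hopen : IsOpen {z : ℂ | 0 < z.im} := isOpen_upperHalfPlaneSet
  have hconv : Convex ℝ {z : ℂ | 0 < z.im} := convex_halfSpace_im_gt 0
  have hdiff : DifferentiableOn ℂ (fun z => f (ofComplex z) * (1 / (z + v) - 1 / (z - w)))
      {z : ℂ | 0 < z.im} := by
    refine (UpperHalfPlane.mdifferentiable_iff.mp hf.holomorphic).mul (DifferentiableOn.sub ?_ ?_)
    · exact (differentiableOn_const _).div (by fun_prop) fun z hz => add_ofReal_ne_zero hz v
    · exact (differentiableOn_const _).div (by fun_prop) fun z hz => sub_ofReal_ne_zero hz w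
  obtain ⟨P, hP⟩ := hconv.exists_forall_hasDerivWithinAt hdiff
  have hP' : ∀ z : ℂ, 0 < z.im →
      HasDerivAt P (f (ofComplex z) * (1 / (z + v) - 1 / (z - w))) z :=
    fun z hz => (hP z hz).hasDerivAt (hopen.mem_nhds hz)
  refine ⟨P, hP', ?_⟩
  -- The differential is invariant under `A`, since `A` fixes both of its poles; so the integral
  -- from `z` to `A z` does not depend on `z` and the base point can be moved to `ρ²`.
  have hconst : ∀ z : ℂ, 0 < z.im → ∀ z' : ℂ, 0 < z'.im →
      P (moebius A z) - P z = P (moebius A z') - P z' := by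
    have hd : ∀ z ∈ {z : ℂ | 0 < z.im}, HasDerivAt (fun z => P (moebius A z) - P z) 0 z := by
      intro z hz
      have d1 := ((hP' _ (moebius_im_pos A hz)).comp _ (hasDerivAt_moebius A hz)).sub (hP' z hz)
      refine d1.congr_deriv ?_
      rw [apply_ofComplex_moebius hf.invariant A hz, mul_assoc, moebius_differential hw hv hz,
        sub_self]
    intro z hz z' hz'
    refine hopen.is_const_of_deriv_eq_zero hconv.isPreconnected
      (fun y hy => (hd y hy).differentiableAt.differentiableWithinAt)
      (fun y hy => (hd y hy).deriv) hz hz'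
  intro z hz
  rw [hconst z hz τ₀ τ₀.im_pos, cycleIntegral, if_pos hA, ← coe_smul_eq_moebius]
  set z₁ : ℂ := ((A • τ₀ : ℍ) : ℂ) with hz₁
  have hmem : ∀ s ∈ Set.uIcc (0 : ℝ) 1, 0 < (AffineMap.lineMap (τ₀ : ℂ) z₁ s : ℂ).im := by
    intro s hs
    rw [Set.uIcc_of_le zero_le_one] at hs
    exact hconv.lineMap_mem τ₀.im_pos (A • τ₀).im_pos hs
  have hline : ∀ s : ℝ, HasDerivAt (fun s : ℝ => (AffineMap.lineMap (τ₀ : ℂ) z₁ s : ℂ))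
      (z₁ - τ₀) s := fun s => AffineMap.hasDerivAt_lineMap
  have hcongr : ∀ s ∈ Set.uIcc (0 : ℝ) 1,
      (fun z : ℂ => f (ofComplex z) * (Real.sqrt (formDiscr A) : ℂ) / formEval A z)
        (AffineMap.lineMap (τ₀ : ℂ) z₁ s) * (z₁ - τ₀) =
      (fun z : ℂ => f (ofComplex z) * (1 / (z + v) - 1 / (z - w)))
        (AffineMap.lineMap (τ₀ : ℂ) z₁ s) * (z₁ - τ₀) := by
    intro s hs
    simp only
    rw [mul_div_assoc, hQ _ (hmem s hs)]
  rw [intervalIntegral.integral_congr hcongr]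
  have hderiv : ∀ s ∈ Set.uIcc (0 : ℝ) 1,
      HasDerivAt (fun s : ℝ => P (AffineMap.lineMap (τ₀ : ℂ) z₁ s))
      ((fun z : ℂ => f (ofComplex z) * (1 / (z + v) - 1 / (z - w)))
        (AffineMap.lineMap (τ₀ : ℂ) z₁ s) * (z₁ - τ₀)) s := by
    intro s hs
    have d := (hP' _ (hmem s hs)).scomp s (hline s)
    refine d.congr_deriv ?_
    rw [smul_eq_mul, mul_comm]
  rw [intervalIntegral.integral_eq_sub_of_hasDerivAt hderiv]
  · simp
  · refine ContinuousOn.intervalIntegrable (ContinuousOn.mul ?_ continuousOn_const)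
    exact hdiff.continuousOn.comp (fun s _ => (hline s).continuousAt.continuousWithinAt) hmem

open scoped Classical in
/-- The real part of the cycle integral along a Farey path. -/
theorem re_cycleIntegral_fareyMatrix {f : ℍ → ℂ} (hf : IsWeaklyHolomorphicModularFunction f)
    (hpos : IsNonnegOnArc f) (τ₀ : ℍ) {x : ℝ} (hx : ∀ n, 0 < fareyStep^[n] x) {n : ℕ}
    (hA : (fareyMatrix x n : Matrix (Fin 2) (Fin 2) ℤ).IsHyperbolic) :
    ∃ (q : ℕ → ℝ) (v : ℝ), 0 < q 0 ∧ 0 < v ∧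
      (∀ i < n, q (i + 1) = letterAct (fareyStep^[n - 1 - i] x < 1) (q i)) ∧
      (cycleIntegral f τ₀ (fareyMatrix x n)).re =
        ∫ t in (Real.pi / 3)..(2 * Real.pi / 3), arcValue f t * Real.sin t *
          ∑ k ∈ Finset.range n,
            (kernel (2 * Real.cos t) (q (n - k)) + kernel (-(2 * Real.cos t)) (fareyPast x v k)) := by
  obtain ⟨w, v, hw0, hv0, hw, hv, hQ⟩ := exists_fixedPoints (fareyMatrix_spec hx n).1 hA
  obtain ⟨P, hP, hI⟩ := cycleIntegral_eq_primitive_sub hf τ₀ hA hw hv hQ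
  -- `q i` is obtained from the attracting fixed point by the last `i` letters of the word of `A_n`,
  -- so `A_{n-i}` maps `q i` to `w`.
  let q : ℕ → ℝ := fun i => Nat.rec w (fun i y => letterAct (fareyStep^[n - 1 - i] x < 1) y) i
  have hq : ∀ i, q (i + 1) = letterAct (fareyStep^[n - 1 - i] x < 1) (q i) := fun i => rfl
  have hqpos : ∀ i, 0 < q i := by
    intro i
    induction i with
    | zero => exact hw0
    | succ i ih => rw [hq]; exact letterAct_pos _ ih
  have hmap1 : ∀ i ≤ n, MapsReal (fareyMatrix x (n - i)) (q i) w := by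
    intro i
    induction i with
    | zero => exact fun _ => hw
    | succ i ih =>
      intro hi
      have h := ih (by omega)
      have e : n - i = (n - 1 - i) + 1 := by omega
      rw [e, (fareyMatrix_spec hx _).2.2, mapsReal_mul_letterMatrix _ _ (hqpos i)] at h
      rw [hq]
      have e' : n - (i + 1) = n - 1 - i := by omega
      rw [e']
      exact h
  have hmap2 : ∀ k, MapsReal (fareyMatrix x k) (-fareyPast x v k) (-v) := by
    intro k
    induction k with
    | zero => simp [MapsReal, fareyMatrix, fareyPast]
    | succ k ih =>
      rw [(fareyMatrix_spec hx k).2.2, fareyPast]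
      exact mapsReal_mul_letterMatrix_neg _ _ (fareyPast_pos x hv0 k) ih
  refine ⟨q, v, hw0, hv0, fun i _ => hq i, ?_⟩
  have hρ : 0 < (arc (2 * Real.pi / 3)).im :=
    arc_im_pos ⟨by linarith [Real.pi_pos], le_rfl⟩
  have htel : (cycleIntegral f τ₀ (fareyMatrix x n)).re = ∑ k ∈ Finset.range n,
      ((P (moebius (fareyMatrix x (k + 1)) (arc (2 * Real.pi / 3)))).re -
        (P (moebius (fareyMatrix x k) (arc (2 * Real.pi / 3)))).re) := by
    rw [Finset.sum_range_sub (fun k => (P (moebius (fareyMatrix x k) (arc (2 * Real.pi / 3)))).re),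
      hI _ hρ, Complex.sub_re]
    simp [fareyMatrix, moebius]
  have hle : Real.pi / 3 ≤ 2 * Real.pi / 3 := by linarith [Real.pi_pos]
  have hsum : ∀ t, arcValue f t * Real.sin t *
          ∑ k ∈ Finset.range n,
            (kernel (2 * Real.cos t) (q (n - k)) + kernel (-(2 * Real.cos t)) (fareyPast x v k)) =
      ∑ k ∈ Finset.range n, arcValue f t * Real.sin t *
        (kernel (2 * Real.cos t) (q (n - k)) + kernel (-(2 * Real.cos t)) (fareyPast x v k)) :=
    fun t => Finset.mul_sum _ _ _
  simp only [hsum]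
  rw [htel, intervalIntegral.integral_finsetSum]
  · refine Finset.sum_congr rfl fun k hk => ?_
    rw [Finset.mem_range] at hk
    rw [(fareyMatrix_spec hx k).2.2, moebius_mul_letterMatrix]
    have h1 := hmap1 (n - k) (by omega)
    rw [Nat.sub_sub_self hk.le] at h1
    exact re_primitive_sub hf hpos hP h1 (hmap2 k)
  · intro k _
    refine ContinuousOn.intervalIntegrable ?_
    rw [Set.uIcc_of_le hle]
    have k1 := continuousOn_kernel_two_cos (u := q (n - k)) 1 (by simp)
    have k2 := continuousOn_kernel_two_cos (u := fareyPast x v k) (-1) (by simp)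
    simp only [one_mul, neg_one_mul] at k1 k2
    exact ((continuousOn_arcValue hf.holomorphic).mul Real.continuous_sin.continuousOn).mul
      (k1.add k2)

/-! ### Asymptotics of cycle integrals -/

theorem blkSum_const_mul (s : ℝ) (h : ℝ → ℝ) (b : Bool) (y : ℝ) :
    blkSum (fun x => s * h x) b y = s * blkSum h b y := by
  unfold blkSum
  split_ifs <;> ring

/-- `q (n - k)` and the `k`-th tail of `x` both begin with the letters from place `k` to `n - 1` of
the path, hence differ by at most `1 / (n - k + 1)` in the contracted coordinate. -/
theorem tail_error {x : ℝ} (hx : ∀ n, 0 < fareyStep^[n] x) {c : ℝ} (hc : |c| ≤ 1) {n : ℕ}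
    {q : ℕ → ℝ} (hq0 : 0 < q 0) {b : ℕ → Prop} [∀ i, Decidable (b i)]
    (hb : ∀ i, b i ↔ fareyStep^[n - 1 - i] x < 1)
    (hq : ∀ i < n, q (i + 1) = letterAct (b i) (q i)) :
    |∑ k ∈ Finset.range n, kernel c (q (n - k)) -
      ∑ k ∈ Finset.range n, kernel c (fareyStep^[k] x)| ≤
      16 * ∑ k ∈ Finset.range n, 1 / ((k : ℝ) + 1) := by
  have hqpos : ∀ i ≤ n, 0 < q i := by
    intro i
    induction i with
    | zero => exact fun _ => hq0
    | succ i ih =>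
      intro hi
      rw [hq i (by omega)]
      exact letterAct_pos _ (ih (by omega))
  have hstep : ∀ i < n, fareyStep^[n - (i + 1)] x = letterAct (b i) (fareyStep^[n - i] x) := by
    intro i hi
    have e1 : n - i = (n - 1 - i) + 1 := by omega
    have e2 : n - (i + 1) = n - 1 - i := by omega
    rw [e1, e2, Function.iterate_succ_apply']
    have h := letterAct_fareyStep (hx (n - 1 - i))
    unfold letterAct at h ⊢
    simp only [hb i]
    exact h.symm
  rw [← Finset.sum_sub_distrib, Finset.mul_sum]
  rw [← Finset.sum_range_reflect (fun k => 16 * (1 / ((k : ℝ) + 1)))]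
  refine (Finset.abs_sum_le_sum_abs _ _).trans (Finset.sum_le_sum fun k hk => ?_)
  rw [Finset.mem_range] at hk
  refine (abs_kernel_sub_kernel_le hc (hqpos _ (Nat.sub_le _ _)) (hx k)).trans ?_
  have h := letterAct_contraction b q (fun i => fareyStep^[n - i] x) (n - k) hq0 (hx _)
    (fun i hi => hq i (by omega)) (fun i hi => hstep i (by omega))
  simp only [Nat.sub_sub_self hk.le] at h
  refine mul_le_mul_of_nonneg_left (h.trans ?_) (by norm_num)
  apply one_div_le_one_div_of_le (by positivity)
  have : n - 1 - k ≤ n - k := by omega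
  have : ((n - 1 - k : ℕ) : ℝ) ≤ ((n - k : ℕ) : ℝ) := by exact_mod_cast this
  linarith

theorem past_error (x : ℝ) {c : ℝ} (hc : |c| ≤ 1) {v η : ℝ} (hv : 0 < v) (hη : 0 < η) (n : ℕ) :
    |∑ k ∈ Finset.range n, kernel c (fareyPast x v k) -
      ∑ k ∈ Finset.range n, kernel c (fareyPast x η k)| ≤
      16 * ∑ k ∈ Finset.range n, 1 / ((k : ℝ) + 1) := by
  classical
  rw [← Finset.sum_sub_distrib, Finset.mul_sum]
  refine (Finset.abs_sum_le_sum_abs _ _).trans (Finset.sum_le_sum fun k _ => ?_)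
  refine (abs_kernel_sub_kernel_le hc (fareyPast_pos x hv k) (fareyPast_pos x hη k)).trans ?_
  exact mul_le_mul_of_nonneg_left (letterAct_contraction (fun i => fareyStep^[i] x < 1)
    (fareyPast x v) (fareyPast x η) k hv hη (fun _ _ => rfl) (fun _ _ => rfl)) (by norm_num)

/-- A bound for block sums of `s` times the kernel with mean `H`. -/
def BlockBound (S : Set ℝ) (B : Set Bool) (H : ℝ → ℝ) (s : ℝ) : Prop :=
  ∀ c, |c| ≤ 1 → |H c| ≤ 1 ∧ ∃ G : ℝ → ℝ, (∀ y ∈ S, 0 ≤ G y ∧ G y ≤ 1) ∧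
    ∀ b ∈ B, ∀ y ∈ S,
      s * blkSum (kernel c) b y ≤ blkLen b * (s * H c) + (G y - G (blk b y))

theorem kernel_sum_le {P S : Set ℝ} {B : Set Bool} (hs : BlockSystem P S B) {H : ℝ → ℝ} {s : ℝ}
    (h_s : |s| = 1) (hb : BlockBound S B H s) {x : ℝ} (hx : x ∈ P) {n : ℕ} {q : ℕ → ℝ}
    (hq0 : 0 < q 0) {b : ℕ → Prop} [∀ i, Decidable (b i)]
    (hbq : ∀ i, b i ↔ fareyStep^[n - 1 - i] x < 1)
    (hq : ∀ i < n, q (i + 1) = letterAct (b i) (q i)) {v : ℝ} (hv : 0 < v)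
    {c : ℝ} (hc : |c| ≤ 1) :
    s * ∑ k ∈ Finset.range n, (kernel c (q (n - k)) + kernel (-c) (fareyPast x v k)) ≤
      n * (s * (H c + H (-c))) + (20 + 32 * ∑ k ∈ Finset.range n, 1 / ((k : ℝ) + 1)) := by
  have hc' : |-c| ≤ 1 := by rwa [abs_neg]
  have hxpos := hs.iterate_pos hx
  have hx0 : 0 < x := hxpos 0
  obtain ⟨hH, G, hG, hGb⟩ := hb c hc
  obtain ⟨hH', G', hG', hGb'⟩ := hb (-c) hc'
  have bound : ∀ {c' : ℝ}, |c'| ≤ 1 → ∀ x, 0 < x → |s * kernel c' x| ≤ 1 := by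
    intro c' hc' x hx
    rw [abs_mul, h_s, one_mul]
    exact abs_kernel_le_one hc' hx
  have habs : ∀ {y : ℝ}, |y| ≤ 1 → |s * y| ≤ 1 := fun hy => by rwa [abs_mul, h_s, one_mul]
  have t1 := hs.sum_tail_le (h := fun x => s * kernel c x) (G := G) (H := s * H c) (C := 1)
    (bound hc) (habs hH) (fun y hy => (hG y hy).2)
    (fun b hb y hy => by rw [blkSum_const_mul]; exact hGb b hb y hy) hx n
  have t2 := hs.sum_past_le (h := fun x => s * kernel (-c) x) (G := G') (H := s * H (-c))
    (bound hc') (fun y hy => by rw [kernel_inv _ hy]) (habs hH') (fun y hy => (hG' y hy).1)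
    (fun b hb y hy => by rw [blkSum_const_mul]; exact hGb' b hb y hy) hx (hs.subset hx) n
  -- The past is compared with the one that starts at `x⁻¹`, for which the block sums are available.
  -- Shifting its index by one changes the sum by at most 1; with the bounds 8 and `G ≤ 1` on each
  -- side, everything fits into 20.
  have e1 := tail_error hxpos hc hq0 hbq hq
  have e2 := past_error x hc' hv (inv_pos.mpr hx0) n
  have e3 := Finset.sum_range_succ' (fun k => kernel (-c) (fareyPast x x⁻¹ k)) n
  rw [Finset.sum_range_succ] at e3
  have k0 := kernel_nonneg hc' (fareyPast_pos x (inv_pos.mpr hx0) 0)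
  have k0' := kernel_le_one (x := fareyPast x x⁻¹ 0) hc'
  have k1 := kernel_nonneg hc' (fareyPast_pos x (inv_pos.mpr hx0) n)
  have k1' := kernel_le_one (x := fareyPast x x⁻¹ n) hc'
  have g1 := (hG x (hs.subset hx)).1
  have g2 := (hG' x (hs.subset hx)).2
  simp only [← Finset.mul_sum] at t1 t2
  rw [Finset.sum_add_distrib]
  obtain ⟨e1, e1'⟩ := abs_le.mp e1
  obtain ⟨e2, e2'⟩ := abs_le.mp e2
  rcases (abs_eq zero_le_one).mp h_s with rfl | rfl <;> linarith

/-- The value of the Lyapunov exponent that belongs to the mean `H` of the kernel. -/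
def arcMean (f : ℍ → ℂ) (H : ℝ → ℝ) : ℝ :=
  ∫ t in (Real.pi / 3)..(2 * Real.pi / 3), arcValue f t * Real.sin t *
    (H (2 * Real.cos t) + H (-(2 * Real.cos t)))

theorem pi_div_three_le : Real.pi / 3 ≤ 2 * Real.pi / 3 := by linarith [Real.pi_pos]

theorem arcWeight_integrable {f : ℍ → ℂ} (hf : IsWeaklyHolomorphicModularFunction f) {g : ℝ → ℝ}
    (hg : ContinuousOn g (Set.Icc (Real.pi / 3) (2 * Real.pi / 3))) :
    IntervalIntegrable (fun t => arcValue f t * Real.sin t * g t) MeasureTheory.volume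
      (Real.pi / 3) (2 * Real.pi / 3) := by
  refine ContinuousOn.intervalIntegrable ?_
  rw [Set.uIcc_of_le pi_div_three_le]
  exact ((continuousOn_arcValue hf.holomorphic).mul Real.continuous_sin.continuousOn).mul hg

theorem BlockSystem.isHyperbolic {P S : Set ℝ} {B : Set Bool} (hs : BlockSystem P S B) {x : ℝ}
    (hx : x ∈ P) {n : ℕ} (hn : 4 ≤ n) :
    (fareyMatrix x n : Matrix (Fin 2) (Fin 2) ℤ).IsHyperbolic := by
  have hpos := hs.iterate_pos hx
  obtain ⟨b, -, y, hy, rfl⟩ := hs.exists_eq x hx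
  have hy0 := hs.pos y (hs.subset hy)
  have h0 : 1 ≤ fareyStep^[0] (blk b y) := (blk_pos b hy0).le
  cases b
  · refine fareyMatrix_isHyperbolic hpos (i := 1) ?_ h0 (by omega) (by omega)
    rw [Function.iterate_one, fareyStep_blk_false hy0]
    exact div_add_one_lt_one hy0
  · refine fareyMatrix_isHyperbolic hpos (i := 2) ?_ h0 (by omega) (by omega)
    simp only [Function.iterate_succ, Function.iterate_zero, Function.comp, id,
      fareyStep_blk_true hy0, fareyStep_one_add hy0]
    exact div_two_mul_lt_one hy0

theorem cycleIntegral_le {f : ℍ → ℂ} (hf : IsWeaklyHolomorphicModularFunction f)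
    (hpos : IsNonnegOnArc f) (τ₀ : ℍ) {P S : Set ℝ} {B : Set Bool} (hs : BlockSystem P S B)
    {H : ℝ → ℝ} (hH : ContinuousOn H (Set.Icc (-1) 1)) {s : ℝ}
    (h_s : |s| = 1) (hb : BlockBound S B H s) {x : ℝ} (hx : x ∈ P) {n : ℕ} (hn : 4 ≤ n) :
    s * (cycleIntegral f τ₀ (fareyMatrix x n)).re ≤ n * (s * arcMean f H) +
      (20 + 32 * ∑ k ∈ Finset.range n, 1 / ((k : ℝ) + 1)) *
        ∫ t in (Real.pi / 3)..(2 * Real.pi / 3), arcValue f t * Real.sin t * 1 := by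
  obtain ⟨q, v, hq0, hv, hq, hI⟩ := re_cycleIntegral_fareyMatrix hf hpos τ₀ (hs.iterate_pos hx)
    (hs.isHyperbolic hx hn)
  set E : ℝ := 20 + 32 * ∑ k ∈ Finset.range n, 1 / ((k : ℝ) + 1) with hE
  have hcos : ContinuousOn (fun t => H (2 * Real.cos t) + H (-(2 * Real.cos t)))
      (Set.Icc (Real.pi / 3) (2 * Real.pi / 3)) := by
    refine (hH.comp (by fun_prop) fun t ht => ?_).add (hH.comp (by fun_prop) fun t ht => ?_)
    · exact abs_le.mp (abs_two_cos_le_one ht)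
    · exact abs_le.mp (by rw [abs_neg]; exact abs_two_cos_le_one ht)
  have i1 := arcWeight_integrable hf hcos
  have i2 := arcWeight_integrable hf (g := fun _ => (1 : ℝ)) continuousOn_const
  have i3 := arcWeight_integrable hf (g := fun t => ∑ k ∈ Finset.range n,
      (kernel (2 * Real.cos t) (q (n - k)) + kernel (-(2 * Real.cos t)) (fareyPast x v k))) (by
    refine continuousOn_finsetSum _ fun k _ => ?_
    have k1 := continuousOn_kernel_two_cos (u := q (n - k)) 1 (by simp)
    have k2 := continuousOn_kernel_two_cos (u := fareyPast x v k) (-1) (by simp)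
    simp only [one_mul, neg_one_mul] at k1 k2
    exact k1.add k2)
  rw [hI, arcMean, ← intervalIntegral.integral_const_mul, ← intervalIntegral.integral_const_mul,
    ← intervalIntegral.integral_const_mul, ← intervalIntegral.integral_const_mul,
    ← intervalIntegral.integral_add ((i1.const_mul s).const_mul _) (i2.const_mul _)]
  refine intervalIntegral.integral_mono_on pi_div_three_le (i3.const_mul s)
    (((i1.const_mul s).const_mul _).add (i2.const_mul _)) fun t ht => ?_
  have hk := kernel_sum_le hs h_s hb hx hq0 (fun _ => Iff.rfl) hq hv (abs_two_cos_le_one ht)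
  have hw : 0 ≤ arcValue f t * Real.sin t :=
    mul_nonneg (hpos.apply_eq ht).2 (sin_pos_of_mem_arc ht).le
  have := mul_le_mul_of_nonneg_left hk hw
  linarith

/-- The harmonic sum divided by `n` is a Cesàro mean of a null sequence. -/
theorem tendsto_error (M : ℝ) :
    Tendsto (fun n : ℕ => (20 + 32 * ∑ k ∈ Finset.range n, 1 / ((k : ℝ) + 1)) * M / n) atTop
      (𝓝 0) := by
  have h1 := (tendsto_one_div_add_atTop_nhds_zero_nat (𝕜 := ℝ)).cesaro
  have h2 : Tendsto (fun n : ℕ => (n : ℝ)⁻¹) atTop (𝓝 0) := tendsto_inv_atTop_nhds_zero_nat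
  have h3 := ((h2.const_mul 20).add (h1.const_mul 32)).mul_const M
  simp only [mul_zero, add_zero, zero_mul] at h3
  refine h3.congr fun n => ?_
  rw [div_eq_mul_inv]
  ring

theorem le_limsup_of_eventually {a e : ℕ → ℝ} {L : ℝ} (he : Tendsto e atTop (𝓝 0))
    (h : ∀ᶠ n in atTop, L - e n ≤ a n) :
    (L : EReal) ≤ limsup (fun n => (a n : EReal)) atTop := by
  have h1 : Tendsto (fun n => ((L - e n : ℝ) : EReal)) atTop (𝓝 (L : EReal)) := by
    rw [EReal.tendsto_coe]
    simpa using he.const_sub L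
  rw [← h1.limsup_eq]
  exact limsup_le_limsup (h.mono fun n hn => EReal.coe_le_coe_iff.mpr hn)

theorem limsup_le_of_eventually {a e : ℕ → ℝ} {L : ℝ} (he : Tendsto e atTop (𝓝 0))
    (h : ∀ᶠ n in atTop, a n ≤ L + e n) :
    limsup (fun n => (a n : EReal)) atTop ≤ L := by
  have h1 : Tendsto (fun n => ((L + e n : ℝ) : EReal)) atTop (𝓝 (L : EReal)) := by
    rw [EReal.tendsto_coe]
    simpa using he.const_add L
  rw [← h1.limsup_eq]
  exact limsup_le_limsup (h.mono fun n hn => EReal.coe_le_coe_iff.mpr hn)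

theorem lyapunov_le_arcMean {f : ℍ → ℂ} (hf : IsWeaklyHolomorphicModularFunction f)
    (hpos : IsNonnegOnArc f) (τ₀ : ℍ) {P S : Set ℝ} {B : Set Bool} (hs : BlockSystem P S B)
    {H : ℝ → ℝ} (hH : ContinuousOn H (Set.Icc (-1) 1)) (hb : BlockBound S B H 1) {x : ℝ}
    (hx : x ∈ P) : lyapunov f τ₀ x ≤ arcMean f H := by
  refine limsup_le_of_eventually (tendsto_error
    (∫ t in (Real.pi / 3)..(2 * Real.pi / 3), arcValue f t * Real.sin t * 1)) ?_
  filter_upwards [eventually_ge_atTop 4] with n hn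
  have hn0 : (0 : ℝ) < n := by exact_mod_cast (by omega : 0 < n)
  have h := cycleIntegral_le hf hpos τ₀ hs hH (s := 1) (by simp) hb hx hn
  rw [div_le_iff₀ hn0, add_mul, div_mul_cancel₀ _ hn0.ne']
  linarith

theorem arcMean_le_lyapunov {f : ℍ → ℂ} (hf : IsWeaklyHolomorphicModularFunction f)
    (hpos : IsNonnegOnArc f) (τ₀ : ℍ) {P S : Set ℝ} {B : Set Bool} (hs : BlockSystem P S B)
    {H : ℝ → ℝ} (hH : ContinuousOn H (Set.Icc (-1) 1)) (hb : BlockBound S B H (-1)) {x : ℝ}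
    (hx : x ∈ P) : arcMean f H ≤ lyapunov f τ₀ x := by
  refine le_limsup_of_eventually (tendsto_error
    (∫ t in (Real.pi / 3)..(2 * Real.pi / 3), arcValue f t * Real.sin t * 1)) ?_
  filter_upwards [eventually_ge_atTop 4] with n hn
  have hn0 : (0 : ℝ) < n := by exact_mod_cast (by omega : 0 < n)
  have h := cycleIntegral_le hf hpos τ₀ hs hH (s := -1) (by simp) hb hx hn
  rw [le_div_iff₀ hn0, sub_mul, div_mul_cancel₀ _ hn0.ne']
  linarith

/-! ### The extremal means -/

theorem abs_goldenMean_le_one {c : ℝ} (hc : |c| ≤ 1) : |goldenMean c| ≤ 1 := by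
  rw [← kernel_golden]
  exact abs_kernel_le_one hc (by positivity)

theorem abs_silverMean_le_one {c : ℝ} (hc : |c| ≤ 1) : |silverMean c| ≤ 1 := by
  rw [silverMean, ← kernel_silver, ← kernel_sqrt_two]
  obtain ⟨h1, h2⟩ := abs_le.mp (abs_kernel_le_one hc (by positivity : 0 < 1 + √2))
  obtain ⟨h3, h4⟩ := abs_le.mp (abs_kernel_le_one hc (by positivity : 0 < √2))
  rw [abs_le]
  constructor <;> linarith

theorem continuousOn_goldenMean : ContinuousOn goldenMean (Set.Icc (-1) 1) := by
  refine ContinuousOn.div continuousOn_const (by fun_prop) fun c hc => ?_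
  have := sqrt_five_bounds
  linarith [hc.2]

theorem continuousOn_silverMean : ContinuousOn silverMean (Set.Icc (-1) 1) := by
  have := sqrt_two_bounds
  refine ContinuousOn.div_const (ContinuousOn.add ?_ ?_) 2 <;>
  · refine ContinuousOn.div continuousOn_const (by fun_prop) fun c hc => ?_
    linarith [hc.2]

/-- At the fixed point of the block there is equality with `G = 0`. Both signs of `s` are therefore
available, and together they give the exact exponent. -/
theorem blockBound_golden {s : ℝ} :
    BlockBound {(1 + √5) / 2} {false} goldenMean s := by
  intro c hc
  refine ⟨abs_goldenMean_le_one hc, fun _ => 0, fun _ _ => by norm_num, ?_⟩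
  rintro b rfl y rfl
  rw [blkSum_golden]
  simp only [blkLen, Bool.false_eq_true, if_false]
  push_cast
  linarith

theorem blockBound_silver {s : ℝ} :
    BlockBound {1 + √2} {true} silverMean s := by
  intro c hc
  refine ⟨abs_silverMean_le_one hc, fun _ => 0, fun _ _ => by norm_num, ?_⟩
  rintro b rfl y rfl
  rw [blkSum_silver]
  simp only [blkLen, if_true]
  push_cast
  linarith

theorem div_sq_le {κ c : ℝ} (hκ : κ ≤ 0.4) (hc : |c| ≤ 1) : κ / (√5 - c) ^ 2 ≤ 0.3 := by
  have := sqrt_five_bounds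
  obtain ⟨h1, h2⟩ := abs_le.mp hc
  have h3 : 1.236 ≤ √5 - c := by linarith
  rw [div_le_iff₀ (by nlinarith)]
  nlinarith

theorem blockBound_markovInterval_golden :
    BlockBound markovInterval Set.univ goldenMean 1 := by
  intro c hc
  refine ⟨abs_goldenMean_le_one hc, fun y => 0.4 / (√5 - c) ^ 2 * y, fun y hy => ?_, ?_⟩
  · obtain ⟨b1, b2, -, -⟩ := markovInterval_bounds hy
    have h1 := div_sq_le (κ := 0.4) le_rfl hc
    have h0 : 0 ≤ 0.4 / (√5 - c) ^ 2 := by positivity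
    constructor
    · positivity
    · nlinarith
  · rintro b - y hy
    cases b
    · have h := blkSum_false_le hc hy
      simp only [blkLen, Bool.false_eq_true, if_false]
      push_cast
      linarith
    · have h := blkSum_true_le hc hy
      simp only [blkLen, if_true]
      push_cast
      linarith

theorem blockBound_markovInterval_silver :
    BlockBound markovInterval Set.univ silverMean (-1) := by
  intro c hc
  -- For the lower bound the potential changes sign; 3 is a constant beyond `ψ` that keeps its
  -- values in `[0, 1]`.
  refine ⟨abs_silverMean_le_one hc, fun y => 0.37 / (√5 - c) ^ 2 * (3 - y), fun y hy => ?_, ?_⟩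
  · obtain ⟨b1, b2, -, -⟩ := markovInterval_bounds hy
    have h1 := div_sq_le (κ := 0.37) (by norm_num) hc
    have h0 : 0 ≤ 0.37 / (√5 - c) ^ 2 := by positivity
    constructor
    · exact mul_nonneg h0 (by linarith)
    · nlinarith
  · rintro b - y hy
    cases b
    · have h := le_blkSum_false hc hy
      simp only [blkLen, Bool.false_eq_true, if_false]
      push_cast
      linarith
    · have h := le_blkSum_true hc hy
      simp only [blkLen, if_true]
      push_cast
      linarith

theorem blockSystem_golden : BlockSystem {(1 + √5) / 2} {(1 + √5) / 2} {false} where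
  exists_eq := by
    rintro x rfl
    exact ⟨false, rfl, _, rfl, blk_golden.symm⟩
  subset := subset_rfl
  pos := by
    rintro x rfl
    positivity
  blk_mem := by
    rintro b rfl x rfl
    exact blk_golden

theorem blockSystem_silver : BlockSystem {1 + √2} {1 + √2} {true} where
  exists_eq := by
    rintro x rfl
    exact ⟨true, rfl, _, rfl, blk_silver.symm⟩
  subset := subset_rfl
  pos := by
    rintro x rfl
    positivity
  blk_mem := by
    rintro b rfl x rfl
    exact blk_silver

/-! ### Markov irrationalities as compositions of blocks -/

/-- The expansion does not terminate, so the fractional part of `x` is nonzero and `y` is its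
inverse. -/
theorem HasContFract.tail {x : ℝ} {a : ℕ → ℕ} (h : HasContFract x a) :
    ∃ y : ℝ, 0 < y ∧ x = a 0 + 1 / y ∧ HasContFract y (fun n => a (n + 1)) := by
  obtain ⟨h0, h1⟩ := h
  rw [GenContFract.of_h_eq_floor] at h0
  have hget : ∀ n, ((GenContFract.of x).s.get? n).map GenContFract.Pair.b =
      some (a (n + 1) : ℝ) := by
    intro n
    rw [← h1 n, GenContFract.partDens, Stream'.Seq.map_get?]
  have hfr : Int.fract x ≠ 0 := by
    intro h
    have hx : x = ((⌊x⌋ : ℤ) : ℝ) := by rw [← Int.self_sub_floor, sub_eq_zero] at h; exact h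
    have := hget 0
    rw [hx, GenContFract.of_s_of_int] at this
    simp at this
  have hpos : 0 < Int.fract x := lt_of_le_of_ne (Int.fract_nonneg x) hfr.symm
  refine ⟨(Int.fract x)⁻¹, inv_pos.mpr hpos, ?_, ?_, ?_⟩
  · rw [one_div, inv_inv, ← h0, Int.floor_add_fract]
  · have := hget 0
    have hh := GenContFract.of_s_head hfr
    change (GenContFract.of x).s.get? 0 = _ at hh
    rw [hh] at this
    rw [GenContFract.of_h_eq_floor]
    simpa using this
  · intro n
    rw [GenContFract.partDens, Stream'.Seq.map_get?, ← GenContFract.of_s_succ]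
    exact hget (n + 1)

/-- The real numbers whose continued fraction is composed of pairs `1, 1` and `2, 2`. -/
def pairSet : Set ℝ :=
  {x | ∃ a : ℕ → ℕ, HasContFract x a ∧ ∀ k, a (2 * k) = a (2 * k + 1) ∧
    (a (2 * k) = 1 ∨ a (2 * k) = 2)}

theorem pairSet_exists_eq {x : ℝ} (hx : x ∈ pairSet) :
    ∃ b : Bool, ∃ y ∈ pairSet, 0 < y ∧ x = blk b y := by
  obtain ⟨a, ha, hpair⟩ := hx
  obtain ⟨x₁, hx₁, rfl, ha₁⟩ := ha.tail
  obtain ⟨y, hy, rfl, ha₂⟩ := ha₁.tail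
  have hmem : y ∈ pairSet := ⟨_, ha₂, fun k => by
    have := hpair (k + 1)
    simpa only [mul_add, mul_one, Nat.add_right_comm _ 2 1] using this⟩
  obtain ⟨h1, h2⟩ := hpair 0
  simp only [mul_zero, zero_add] at h1 h2
  rcases h2 with h2 | h2
  · refine ⟨false, y, hmem, hy, ?_⟩
    simp only [blk, zero_add, ← h1, h2, Bool.false_eq_true, if_false]
    push_cast
    field_simp
  · refine ⟨true, y, hmem, hy, ?_⟩
    simp only [blk, zero_add, ← h1, h2, if_true]
    push_cast
    field_simp

theorem pairSet_bounds {x : ℝ} (hx : x ∈ pairSet) : 1 < x ∧ x < 3 := by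
  obtain ⟨b, y, -, hy, rfl⟩ := pairSet_exists_eq hx
  refine ⟨blk_pos b hy, ?_⟩
  have := div_add_one_lt_one hy
  have := div_two_mul_lt_one hy
  unfold blk
  split_ifs <;> linarith

/-- Each block at least halves the distance to its own fixed point, and the other bound is immediate
since the block values lie on the right side of 2. Starting from `1 < x < 3`, this confines
`pairSet` to the interval in the limit. -/
theorem sub_pow_le_of_mem_pairSet (n : ℕ) {x : ℝ} (hx : x ∈ pairSet) :
    (1 + √5) / 2 - (1 / 2) ^ n ≤ x ∧ x ≤ 1 + √2 + (1 / 2) ^ n := by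
  induction n generalizing x with
  | zero =>
    have := pairSet_bounds hx
    have := sqrt_five_bounds
    have := sqrt_two_bounds
    constructor <;> norm_num <;> linarith
  | succ n ih =>
    obtain ⟨b, y, hy, hy0, rfl⟩ := pairSet_exists_eq hx
    obtain ⟨h1, h2⟩ := ih hy
    obtain ⟨hy1, hy3⟩ := pairSet_bounds hy
    have f := sqrt_five_bounds
    have t := sqrt_two_bounds
    have hε : (0 : ℝ) ≤ (1 / 2) ^ n := by positivity
    have m1 := div_add_one_lt_one hy0
    have m2 := div_two_mul_lt_one hy0
    have p2 : 0 < y / (2 * y + 1) := by positivity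
    have g1 : (1 + √5) / 2 - (1 / 2) ^ (n + 1) ≤ 1 + y / (y + 1) := by
      have g := blk_golden
      simp only [blk, Bool.false_eq_true, if_false] at g
      have hp : 1 < (1 + √5) / 2 := by linarith
      generalize (1 + √5) / 2 = p at *
      have e : p / (p + 1) - y / (y + 1) = (p - y) / ((p + 1) * (y + 1)) := by
        field_simp
        ring
      have h : (p - y) / ((p + 1) * (y + 1)) ≤ (1 / 2) ^ n / 2 := by
        rw [div_le_iff₀ (by positivity)]
        have : 2 ≤ (p + 1) * (y + 1) := by nlinarith
        nlinarith
      rw [pow_succ]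
      linarith
    have g2 : 2 + y / (2 * y + 1) ≤ 1 + √2 + (1 / 2) ^ (n + 1) := by
      have g := blk_silver
      simp only [blk, if_true] at g
      have hp : 1 < 1 + √2 := by linarith
      generalize 1 + √2 = p at *
      have e : y / (2 * y + 1) - p / (2 * p + 1) = (y - p) / ((2 * y + 1) * (2 * p + 1)) := by
        field_simp
        ring
      have h : (y - p) / ((2 * y + 1) * (2 * p + 1)) ≤ (1 / 2) ^ n / 2 := by
        rw [div_le_iff₀ (by positivity)]
        have : 2 ≤ (2 * y + 1) * (2 * p + 1) := by nlinarith
        nlinarith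
      rw [pow_succ]
      linarith
    cases b
    · simp only [blk, Bool.false_eq_true, if_false]
      have : (0 : ℝ) ≤ (1 / 2) ^ (n + 1) := by positivity
      exact ⟨g1, by linarith⟩
    · simp only [blk, if_true]
      have : (0 : ℝ) ≤ (1 / 2) ^ (n + 1) := by positivity
      exact ⟨by linarith, g2⟩

theorem pairSet_subset_markovInterval : pairSet ⊆ markovInterval := by
  intro x hx
  have hlim : Tendsto (fun n : ℕ => (1 / 2 : ℝ) ^ n) atTop (𝓝 0) :=
    tendsto_pow_atTop_nhds_zero_of_lt_one (by norm_num) (by norm_num)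
  constructor
  · have := hlim.const_sub ((1 + √5) / 2)
    rw [sub_zero] at this
    exact le_of_tendsto' this fun n => (sub_pow_le_of_mem_pairSet n hx).1
  · have := hlim.const_add (1 + √2)
    rw [add_zero] at this
    exact ge_of_tendsto' this fun n => (sub_pow_le_of_mem_pairSet n hx).2

theorem blockSystem_pairSet : BlockSystem pairSet markovInterval Set.univ where
  exists_eq x hx := by
    obtain ⟨b, y, hy, -, h⟩ := pairSet_exists_eq hx
    exact ⟨b, trivial, y, hy, h⟩
  subset := pairSet_subset_markovInterval
  pos x hx := by linarith [(markovInterval_bounds hx).1]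
  blk_mem b _ x hx := blk_mem_markovInterval b hx

/-- A list that is composed of pairs `1, 1` and `2, 2`. -/
def IsPairList (l : List ℕ) : Prop :=
  ∃ m, l.length = 2 * m ∧ 0 < m ∧ ∀ k < m, l.getD (2 * k) 0 = l.getD (2 * k + 1) 0 ∧
    (l.getD (2 * k) 0 = 1 ∨ l.getD (2 * k) 0 = 2)

theorem IsPairList.append {u v : List ℕ} (hu : IsPairList u) (hv : IsPairList v) :
    IsPairList (u ++ v) := by
  obtain ⟨m, hm, hm0, h⟩ := hu
  obtain ⟨m', hm', -, h'⟩ := hv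
  refine ⟨m + m', by rw [List.length_append, hm, hm']; ring, by omega, fun k hk => ?_⟩
  rcases lt_or_ge k m with hkm | hkm
  · rw [List.getD_append _ _ _ _ (by omega), List.getD_append _ _ _ _ (by omega)]
    exact h k hkm
  · rw [List.getD_append_right _ _ _ _ (by omega), List.getD_append_right _ _ _ _ (by omega)]
    have e1 : 2 * k - u.length = 2 * (k - m) := by omega
    have e2 : 2 * k + 1 - u.length = 2 * (k - m) + 1 := by omega
    rw [e1, e2]
    exact h' (k - m) (by omega)

theorem MarkovNeighbors.isPairList {u v : List ℕ} (h : MarkovNeighbors u v) :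
    IsPairList u ∧ IsPairList v := by
  induction h with
  | root =>
    exact ⟨⟨1, rfl, one_pos, fun k hk => by interval_cases k; simp⟩,
      ⟨1, rfl, one_pos, fun k hk => by interval_cases k; simp⟩⟩
  | left _ ih => exact ⟨ih.1, ih.2.append ih.1⟩
  | right _ ih => exact ⟨ih.2.append ih.1, ih.2⟩

/-- The period has even length, so the pairs stay aligned under repetition. -/
theorem HasPeriod.mem_pairSet {w : ℝ} {l : List ℕ} (h : HasPeriod w l) (hl : IsPairList l) :
    w ∈ pairSet := by
  obtain ⟨m, hm, hm0, hk⟩ := hl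
  refine ⟨_, h.2, fun k => ?_⟩
  have e1 : 2 * k % l.length = 2 * (k % m) := by rw [hm, Nat.mul_mod_mul_left]
  have e2 : (2 * k + 1) % l.length = 2 * (k % m) + 1 := by
    have hlt := Nat.mod_lt k hm0
    rw [Nat.add_mod, e1, hm, Nat.mod_eq_of_lt (show 1 < 2 * m by omega),
      Nat.mod_eq_of_lt (by omega)]
  simp only [e1, e2]
  exact hk (k % m) (Nat.mod_lt k hm0)

theorem IsMarkovIrrationality.mem_pairSet {w : ℝ} (hw : IsMarkovIrrationality w) :
    w ∈ pairSet := by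
  obtain ⟨u, v, huv, h | h⟩ := hw
  · exact h.mem_pairSet huv.isPairList.1
  · exact h.mem_pairSet huv.isPairList.2

end MarkovLyapunov

end

/-- The exponents take values in `EReal`; the two outer strict inequalities together with the chain
make all three finite. -/
theorem theorem1p4 (f : ℍ → ℂ)
    (hf : MarkovLyapunov.IsWeaklyHolomorphicModularFunction f)
    (hf0 : f ≠ 0)
    (hpos : MarkovLyapunov.IsNonnegOnArc f)
    (τ₀ : ℍ) (w : ℝ) (hw : MarkovLyapunov.IsMarkovIrrationality w) :
    ⊥ < MarkovLyapunov.lyapunov f τ₀ (1 + Real.sqrt 2) ∧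
    MarkovLyapunov.lyapunov f τ₀ (1 + Real.sqrt 2) ≤ MarkovLyapunov.lyapunov f τ₀ w ∧
    MarkovLyapunov.lyapunov f τ₀ w ≤ MarkovLyapunov.lyapunov f τ₀ ((1 + Real.sqrt 5) / 2) ∧
    MarkovLyapunov.lyapunov f τ₀ ((1 + Real.sqrt 5) / 2) < ⊤ := by
  open MarkovLyapunov in
  have hw' := hw.mem_pairSet
  have silver_le := lyapunov_le_arcMean hf hpos τ₀ blockSystem_silver continuousOn_silverMean
    blockBound_silver rfl
  have le_silver := arcMean_le_lyapunov hf hpos τ₀ blockSystem_silver continuousOn_silverMean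
    blockBound_silver rfl
  have golden_le := lyapunov_le_arcMean hf hpos τ₀ blockSystem_golden continuousOn_goldenMean
    blockBound_golden rfl
  have le_golden := arcMean_le_lyapunov hf hpos τ₀ blockSystem_golden continuousOn_goldenMean
    blockBound_golden rfl
  have markov_le := lyapunov_le_arcMean hf hpos τ₀ blockSystem_pairSet continuousOn_goldenMean
    blockBound_markovInterval_golden hw'
  have le_markov := arcMean_le_lyapunov hf hpos τ₀ blockSystem_pairSet continuousOn_silverMean
    blockBound_markovInterval_silver hw'
  exact ⟨(EReal.bot_lt_coe _).trans_le le_silver, silver_le.trans le_markov,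
    markov_le.trans le_golden, golden_le.trans_lt (EReal.coe_lt_top _)⟩
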